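/- **Setting.** A deep-water Stokes wave with speed $c>0$ and wavelength $\lambda>0$ is described in the frame moving with the wave, with coordinates $(x,y)$ (where $x$ stands for $x-ct$), by a $C^1$ free surface $y=\eta(x)$ and by a velocity field $(u,v)$ and a pressure $P$ that are $C^1$ in the fluid domain $D=\{y<\eta(x)\}$ and continuous on $\overline D=\{y\le\eta(x)\}$, $(u,v)$ being bounded, such that, for constants $g>0$ and $P_{atm}$, $$(u-c)u_x+vu_y=-P_x,\quad (u-c)v_x+vv_y=-P_y-g,\quad u_x+v_y=0,\quad u_y-v_x=0\quad\text{in } D,$$ $v=(u-c)\eta'$ and $P=P_{atm}$ on $y=\eta(x)$, $(u,v)\to(0,0)$ as $y\to-\infty$ uniformly in $x$, and $u<c$ on $\overline D$. Moreover $\eta,u,v$ have period $\lambda$ in $x$; $\eta,u,P$ are even in $x$; and $\eta$ is strictly increasing on $[-\lambda/2,0]$ and strictly decreasing on $[0,\lambda/2]$. The stream function $\psi$ is the continuous function on $\overline D$ with $\psi_x=-v$, $\psi_y=u-c$ in $D$ and $\psi=0$ on $y=\eta(x)$. A particle path is a solution $t\mapsto(x(t),y(t))$, $t\in\mathbb R$,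 of $$x'(t)=u(x(t)-ct,y(t)),\qquad y'(t)=v(x(t)-ct,y(t)),\qquad y(t)\le\eta(x(t)-ct).$$ It lies on the streamline $p\ge 0$ at time $t_0$ if $\psi(x(t_0)-ct_0,y(t_0))=p$. It is closed if there is $\tau>0$ with $(x(t+\tau),y(t+\tau))=(x(t),y(t))$ for all $t$. **Theorem.** For every deep-water Stokes wave, the stream function exists, and through every point of the fluid or its surface, at every time, there passes a particle path. For every $p\in[0,\infty)$ there are particles on the streamline $p$, and there is a number $\mathcal T(p)>0$, the streamline time-period, such that for every particle path on the streamline $p$ at a time $t_0$, $\tau=\mathcal T(p)$ is the unique positive solution of $x(\tau+t_0)-c\tau=x(t_0)-\lambda$. It satisfies $$\frac{\lambda}{c}<\mathcal T(p)\le\int_{-\lambda/2}^{\lambda/2}\frac{dx}{c-u(x,\eta(x))}\qquad\text{for all }0\le p<\infty,$$ the integrand on the right being integrable; that is, the streamline time-period exceeds the wave period $\lambda/c$. Moreover, no particle path is closed, and the drift is positive on every streamline: for every particle path on the streamline $p$ at time $t_0$, $$x(\mathcal T(p)+t_0)-x(t_0)=c\,\mathcal T(p)-\lambda>0.$$ 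-/

import Mathlib

open Filter Topology Set

/-- The (open) fluid domain below the free surface `y = η x`, in the frame moving with the wave. -/
def fluidDomain (η : ℝ → ℝ) : Set (ℝ × ℝ) := {z | z.2 < η z.1}

/-- The fluid domain together with its free surface. -/
def closedFluidDomain (η : ℝ → ℝ) : Set (ℝ × ℝ) := {z | z.2 ≤ η z.1}

/-- A deep-water Stokes wave: an irrotational, periodic, symmetric travelling gravity wave over
infinitely deep water. All fields are functions of the moving-frame coordinates `(x, y)`, where
`x` stands for `X - c t`; the velocity at time `t` at the point `(X, y)` of the fixed
frame is `(u (X - c t) y, v (X - c t) y)`. Values outside the closed fluid domain play no role. -/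
structure DeepWaterStokesWave where
  /-- wave speed -/
  c : ℝ
  /-- wavelength -/
  lam : ℝ
  /-- gravitational acceleration -/
  g : ℝ
  /-- atmospheric pressure -/
  Patm : ℝ
  /-- free surface profile -/
  η : ℝ → ℝ
  /-- horizontal velocity -/
  u : ℝ → ℝ → ℝ
  /-- vertical velocity -/
  v : ℝ → ℝ → ℝ
  /-- pressure -/
  P : ℝ → ℝ → ℝ
  c_pos : 0 < c
  lam_pos : 0 < lam
  g_pos : 0 < g
  -- regularity
  η_contDiff : ContDiff ℝ 1 η
  u_contDiffOn : ContDiffOn ℝ 1 (Function.uncurry u) (fluidDomain η)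
  v_contDiffOn : ContDiffOn ℝ 1 (Function.uncurry v) (fluidDomain η)
  P_contDiffOn : ContDiffOn ℝ 1 (Function.uncurry P) (fluidDomain η)
  u_continuousOn : ContinuousOn (Function.uncurry u) (closedFluidDomain η)
  v_continuousOn : ContinuousOn (Function.uncurry v) (closedFluidDomain η)
  P_continuousOn : ContinuousOn (Function.uncurry P) (closedFluidDomain η)
  velocity_bounded : ∃ M : ℝ, ∀ x y, y < η x → |u x y| ≤ M ∧ |v x y| ≤ M
  -- steady Euler equations
  euler_x : ∀ x y, y < η x →
    (u x y - c) * deriv (fun s => u s y) x + v x y * deriv (fun s => u x s) y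
      = - deriv (fun s => P s y) x
  euler_y : ∀ x y, y < η x →
    (u x y - c) * deriv (fun s => v s y) x + v x y * deriv (fun s => v x s) y
      = - deriv (fun s => P x s) y - g
  -- incompressibility
  mass_conservation : ∀ x y, y < η x →
    deriv (fun s => u s y) x + deriv (fun s => v x s) y = 0
  -- absence of vorticity
  irrotational : ∀ x y, y < η x →
    deriv (fun s => u x s) y - deriv (fun s => v s y) x = 0
  -- kinematic and dynamic boundary conditions
  kinematic : ∀ x, v x (η x) = (u x (η x) - c) * deriv η x
  dynamic : ∀ x, P x (η x) = Patm
  -- water at rest at great depth, uniformly in the horizontal variable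
  u_decay : TendstoUniformly (fun y x : ℝ => u x y) (fun _ => 0) atBot
  v_decay : TendstoUniformly (fun y x : ℝ => v x y) (fun _ => 0) atBot
  -- no particle moves horizontally as fast as the wave
  u_lt_c : ∀ x y, y ≤ η x → u x y < c
  -- periodicity
  η_periodic : ∀ x, η (x + lam) = η x
  u_periodic : ∀ x y, y ≤ η x → u (x + lam) y = u x y
  v_periodic : ∀ x y, y ≤ η x → v (x + lam) y = v x y
  -- symmetry about the crest line `x = 0`
  η_even : ∀ x, η (-x) = η x
  u_even : ∀ x y, y ≤ η x → u (-x) y = u x y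
  P_even : ∀ x y, y ≤ η x → P (-x) y = P x y
  -- the profile is strictly monotone between crest and trough
  η_strictMonoOn : StrictMonoOn η (Icc (-(lam / 2)) 0)
  η_strictAntiOn : StrictAntiOn η (Icc 0 (lam / 2))

namespace DeepWaterStokesWave

/-- `ψ` is the stream function of the moving-frame flow: `ψ_x = -v` and `ψ_y = u - c` in the fluid,
normalized to vanish on the free surface. These properties determine `ψ` on the closed fluid
domain. -/
structure IsStreamFunction (W : DeepWaterStokesWave) (ψ : ℝ → ℝ → ℝ) : Prop where
  continuousOn : ContinuousOn (Function.uncurry ψ) (closedFluidDomain W.η)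
  hasDerivAt_x : ∀ x y, y < W.η x → HasDerivAt (fun s => ψ s y) (- W.v x y) x
  hasDerivAt_y : ∀ x y, y < W.η x → HasDerivAt (fun s => ψ x s) (W.u x y - W.c) y
  surface : ∀ x, ψ x (W.η x) = 0

/-- `t ↦ (X t, Y t)` is the path (in the fixed frame) of a fluid particle, possibly one on the
free surface: it solves `X' = u (X - c t, Y)`, `Y' = v (X - c t, Y)` and stays in the fluid. -/
structure IsParticlePath (W : DeepWaterStokesWave) (X Y : ℝ → ℝ) : Prop where
  mem_fluid : ∀ t, Y t ≤ W.η (X t - W.c * t)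
  hasDerivAt_X : ∀ t, HasDerivAt X (W.u (X t - W.c * t) (Y t)) t
  hasDerivAt_Y : ∀ t, HasDerivAt Y (W.v (X t - W.c * t) (Y t)) t

/-- The particle with path `(X, Y)` is on the streamline `ψ = p` at time `t₀`. -/
def OnStreamlineAt (W : DeepWaterStokesWave) (ψ : ℝ → ℝ → ℝ) (p : ℝ) (X Y : ℝ → ℝ) (t₀ : ℝ) :
    Prop :=
  ψ (X t₀ - W.c * t₀) (Y t₀) = p

/-- `T` is the time-period of the streamline `ψ = p`: there are particles on this streamline, and,
for each of them and every initial time `t₀`, `T` is the unique positive solution of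
`X (T + t₀) - c T = X t₀ - lam`, i.e. the time in which the particle traverses one wavelength in
the moving frame. -/
def IsStreamlineTimePeriod (W : DeepWaterStokesWave) (ψ : ℝ → ℝ → ℝ) (p T : ℝ) : Prop :=
  (∃ X Y : ℝ → ℝ, ∃ t₀ : ℝ, W.IsParticlePath X Y ∧ W.OnStreamlineAt ψ p X Y t₀) ∧
  ∀ (X Y : ℝ → ℝ) (t₀ : ℝ), W.IsParticlePath X Y → W.OnStreamlineAt ψ p X Y t₀ →
    ∀ τ : ℝ, (0 < τ ∧ X (τ + t₀) - W.c * τ = X t₀ - W.lam) ↔ τ = T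

/-- A path in the fixed frame is closed if the particle runs periodically through it. -/
def IsClosedPath (X Y : ℝ → ℝ) : Prop :=
  ∃ τ : ℝ, 0 < τ ∧ ∀ t, X (t + τ) = X t ∧ Y (t + τ) = Y t

end DeepWaterStokesWave

/-! The Cauchy-Riemann equations for `cvel` = -v + i(c - u) are incompressibility and
irrotationality, so it has a primitive `potential` in the fluid. The real part of the primitive is
the stream function; write q for its imaginary part. Since c - u is bounded below by a positive
constant, each streamline p ≥ 0 is a graph over the x-axis, traversed leftwards with speed U = c -
u. The time spent on one wavelength is therefore T(p) = ∫ dx/U, which is `period`.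

Lower bound. Along a streamline dq = (U² + v²)/U dx, and q gains exactly cλ per wavelength at every
depth, as the limit of infinite depth shows. Completing a square gives T(p) = λ/c + c⁻² ∫ ((U - c)²
+ v²)/U dx (`period_eq_add_integral`). Equality would force U = c and v = 0 on the streamline. If p
> 0, the identity theorem spreads this to the whole fluid. In every case v = 0 on the surface, which
is then flat (`exists_nonuniform`). Positive drift is this inequality multiplied by c, and it
excludes closed paths.

Upper bound. With q as parameter, T(p) becomes the integral of |f|² over a segment of length cλ on
the line Re w = p, where f is the reciprocal of `cvel` in the coordinate w = p + iq (`invVel`,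
`period_eq_integral_norm_sq`). This f is bounded and holomorphic on the right half-plane and
periodic on its boundary. Correlating f with its own values on Re w = p and applying
Phragmén-Lindelöf gives T(p) ≤ (T(0) + T(p))/2 (`integral_norm_sq_le_of_periodic`).

The velocity is only continuous up to the surface, so facts there come from the kinematic condition
or as limits from the interior. -/

/-- A continuous function on a product with `ℝ` that grows at least linearly in its second variable
has a jointly continuous inverse in that variable. -/
theorem exists_continuous_fiberwise_inverse {E : Type*} [TopologicalSpace E] {G : E → ℝ → ℝ}
    (hG : Continuous (Function.uncurry G)) {δ : ℝ} (hδ : 0 < δ)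
    (hgrow : ∀ e a b, a ≤ b → δ * (b - a) ≤ G e b - G e a) :
    ∃ r : E → ℝ → ℝ, Continuous (Function.uncurry r) ∧ (∀ e q, G e (r e q) = q) ∧
      ∀ e a, r e (G e a) = a := by
  have habs : ∀ e a b, δ * |b - a| ≤ |G e b - G e a| := by
    intro e a b
    rcases le_total a b with h | h
    · rw [abs_of_nonneg (sub_nonneg.2 h)]
      exact (hgrow e a b h).trans (le_abs_self _)
    · rw [abs_sub_comm b a, abs_sub_comm (G e b), abs_of_nonneg (sub_nonneg.2 h)]
      exact (hgrow e b a h).trans (le_abs_self _)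
  have hinj : ∀ e a b, G e a = G e b → a = b := by
    intro e a b h
    have h1 := habs e b a
    rw [h, sub_self, abs_zero] at h1
    have h2 : |a - b| ≤ 0 := by
      by_contra h3
      have := mul_pos hδ (not_le.1 h3)
      linarith
    exact sub_eq_zero.1 (abs_eq_zero.1 (le_antisymm h2 (abs_nonneg _)))
  have hsurj : ∀ e q, ∃ a, G e a = q := by
    intro e q
    have hc : Continuous (G e) := hG.comp (Continuous.prodMk_right e)
    refine hc.surjective ?_ ?_ q
    · refine tendsto_atTop_mono' _ ((eventually_ge_atTop 0).mono fun b hb => ?_)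
        (tendsto_atTop_add_const_left atTop (G e 0) (tendsto_id.const_mul_atTop hδ))
      have := hgrow e 0 b hb
      simp only [id, sub_zero] at this ⊢
      linarith
    · refine tendsto_atBot_mono' _ ((eventually_le_atBot 0).mono fun b hb => ?_)
        (tendsto_atBot_add_const_left atBot (G e 0) (tendsto_id.const_mul_atBot hδ))
      have := hgrow e b 0 hb
      simp only [id, zero_sub] at this ⊢
      linarith
  choose r hr using hsurj
  refine ⟨r, ?_, hr, fun e a => hinj e _ _ (hr e _)⟩
  rw [continuous_iff_continuousAt]
  rintro ⟨e₀, q₀⟩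
  rw [ContinuousAt, tendsto_iff_dist_tendsto_zero]
  -- By `habs`, the distance from `r e q` to `r e₀ q₀` is at most δ⁻¹ |q - G e (r e₀ q₀)|, which is
  -- continuous in (e, q) and vanishes at (e₀, q₀).
  have hlim : Tendsto (fun z : E × ℝ => δ⁻¹ * |z.2 - G z.1 (r e₀ q₀)|) (𝓝 (e₀, q₀)) (𝓝 0) := by
    have hc : Continuous fun z : E × ℝ => δ⁻¹ * |z.2 - G z.1 (r e₀ q₀)| := by
      have : Continuous fun z : E × ℝ => G z.1 (r e₀ q₀) :=
        hG.comp (continuous_fst.prodMk continuous_const)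
      fun_prop
    refine hc.tendsto' _ _ ?_
    simp [hr]
  refine squeeze_zero (fun _ => dist_nonneg) (fun z => ?_) hlim
  have := habs z.1 (r e₀ q₀) (r z.1 z.2)
  rw [hr] at this
  rw [Real.dist_eq, inv_mul_eq_div, le_div_iff₀ hδ, mul_comm]
  exact this

/-! ### The velocity continued to the whole plane, and its bounds -/

namespace DeepWaterStokesWave

variable (W : DeepWaterStokesWave)

/-- The speed `c - u` of the flow against the wave, continued above the surface by its value on the
surface. -/
noncomputable def relSpeed (x y : ℝ) : ℝ := W.c - W.u x (min y (W.η x))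

/-- The vertical velocity, continued above the surface by its value on the surface. -/
noncomputable def vertSpeed (x y : ℝ) : ℝ := W.v x (min y (W.η x))

theorem η_continuous : Continuous W.η := W.η_contDiff.continuous

theorem η_hasDerivAt (x : ℝ) : HasDerivAt W.η (deriv W.η x) x :=
  (W.η_contDiff.differentiable one_ne_zero x).hasDerivAt

theorem continuous_clamp :
    Continuous fun z : ℝ × ℝ => ((z.1, min z.2 (W.η z.1)) : ℝ × ℝ) :=
  continuous_fst.prodMk (continuous_snd.min (W.η_continuous.comp continuous_fst))

theorem clamp_mem (z : ℝ × ℝ) : (z.1, min z.2 (W.η z.1)) ∈ closedFluidDomain W.η :=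
  min_le_right z.2 (W.η z.1)

theorem relSpeed_continuous : Continuous (Function.uncurry W.relSpeed) := by
  have := W.u_continuousOn.comp_continuous W.continuous_clamp W.clamp_mem
  exact continuous_const.sub this

theorem vertSpeed_continuous : Continuous (Function.uncurry W.vertSpeed) :=
  W.v_continuousOn.comp_continuous W.continuous_clamp W.clamp_mem

variable {W} in
theorem relSpeed_of_le {x y : ℝ} (h : y ≤ W.η x) : W.relSpeed x y = W.c - W.u x y := by
  rw [relSpeed, min_eq_left h]

variable {W} in
theorem vertSpeed_of_le {x y : ℝ} (h : y ≤ W.η x) : W.vertSpeed x y = W.v x y := by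
  rw [vertSpeed, min_eq_left h]

theorem relSpeed_pos (x y : ℝ) : 0 < W.relSpeed x y :=
  sub_pos.2 (W.u_lt_c _ _ (min_le_right _ _))

theorem relSpeed_add_lam (x y : ℝ) : W.relSpeed (x + W.lam) y = W.relSpeed x y := by
  simp only [relSpeed, W.η_periodic, W.u_periodic x _ (min_le_right _ _)]

theorem vertSpeed_add_lam (x y : ℝ) : W.vertSpeed (x + W.lam) y = W.vertSpeed x y := by
  simp only [vertSpeed, W.η_periodic, W.v_periodic x _ (min_le_right _ _)]

theorem exists_η_bounds : ∃ m M : ℝ, ∀ x, m ≤ W.η x ∧ W.η x ≤ M := by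
  have hp : Function.Periodic W.η W.lam := W.η_periodic
  obtain ⟨m, hm⟩ := (isCompact_Icc (a := (0 : ℝ)) (b := W.lam)).bddBelow_image
    W.η_continuous.continuousOn
  obtain ⟨M, hM⟩ := (isCompact_Icc (a := (0 : ℝ)) (b := W.lam)).bddAbove_image
    W.η_continuous.continuousOn
  refine ⟨m, M, fun x => ?_⟩
  obtain ⟨y, hy, hxy⟩ := hp.exists_mem_Ico₀ W.lam_pos x
  rw [hxy]
  exact ⟨hm (mem_image_of_mem _ (Ico_subset_Icc_self hy)),
    hM (mem_image_of_mem _ (Ico_subset_Icc_self hy))⟩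

/-- A depth below the whole surface. -/
theorem exists_depth : ∃ b : ℝ, ∀ x, b < W.η x := by
  obtain ⟨m, M, h⟩ := W.exists_η_bounds
  exact ⟨m - 1, fun x => by linarith [(h x).1]⟩

theorem eventually_relSpeed_near {ε : ℝ} (hε : 0 < ε) :
    ∀ᶠ y in atBot, ∀ x, |W.relSpeed x y - W.c| < ε := by
  obtain ⟨m, M, h⟩ := W.exists_η_bounds
  filter_upwards [Metric.tendstoUniformly_iff.1 W.u_decay ε hε, eventually_le_atBot m]
    with y hy hym x
  rw [relSpeed_of_le (hym.trans (h x).1)]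
  have := hy x
  rw [Real.dist_eq] at this
  convert this using 2
  ring

/-- At great depth the speed is close to c, above the crests it is frozen by the continuation, and
between these heights periodicity reduces it to a compact rectangle. The positive lower bound makes
the stream function invertible in y and the inverse complex velocity bounded. -/
theorem exists_relSpeed_bounds :
    ∃ δ K : ℝ, 0 < δ ∧ ∀ x y, δ ≤ W.relSpeed x y ∧ W.relSpeed x y ≤ K := by
  obtain ⟨m, M, h⟩ := W.exists_η_bounds
  obtain ⟨y₀, hy₀⟩ := eventually_atBot.1 (W.eventually_relSpeed_near (half_pos W.c_pos))
  have hcomp : IsCompact (Icc (0 : ℝ) W.lam ×ˢ Icc y₀ (max y₀ M)) :=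
    isCompact_Icc.prod isCompact_Icc
  have hne : (Icc (0 : ℝ) W.lam ×ˢ Icc y₀ (max y₀ M)).Nonempty :=
    ⟨(0, y₀), ⟨left_mem_Icc.2 W.lam_pos.le, left_mem_Icc.2 (le_max_left _ _)⟩⟩
  obtain ⟨z, -, hz⟩ := hcomp.exists_isMinOn hne W.relSpeed_continuous.continuousOn
  obtain ⟨z', -, hz'⟩ := hcomp.exists_isMaxOn hne W.relSpeed_continuous.continuousOn
  refine ⟨min (W.c / 2) (Function.uncurry W.relSpeed z),
    max (W.c + W.c / 2) (Function.uncurry W.relSpeed z'),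
    lt_min (half_pos W.c_pos) (W.relSpeed_pos _ _), fun x y => ?_⟩
  rcases le_total y y₀ with hy | hy
  · have := abs_lt.1 (hy₀ y hy x)
    exact ⟨(min_le_left _ _).trans (by linarith), le_trans (by linarith) (le_max_left _ _)⟩
  · obtain ⟨x', hx', hxx'⟩ :=
      Function.Periodic.exists_mem_Ico₀ (f := fun x => W.relSpeed x y)
        (fun x => W.relSpeed_add_lam x y) W.lam_pos x
    have hcl : W.relSpeed x' y = W.relSpeed x' (min y (max y₀ M)) := by
      rw [relSpeed, relSpeed, min_assoc,
        min_eq_right (((h x').2).trans (le_max_right y₀ M))]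
    have hmem : (x', min y (max y₀ M)) ∈ Icc (0 : ℝ) W.lam ×ˢ Icc y₀ (max y₀ M) :=
      ⟨Ico_subset_Icc_self hx', le_min hy (le_max_left _ _), min_le_right _ _⟩
    rw [show W.relSpeed x y = _ from hxx', hcl]
    exact ⟨(min_le_right _ _).trans (isMinOn_iff.1 hz _ hmem),
      (isMaxOn_iff.1 hz' _ hmem).trans (le_max_right _ _)⟩

/-! ### The complex potential and the stream function -/

/-- The fluid domain as a subset of the complex plane. -/
def fluid : Set ℂ := {z | z.im < W.η z.re}

theorem isOpen_fluid : IsOpen W.fluid :=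
  isOpen_lt Complex.continuous_im (W.η_continuous.comp Complex.continuous_re)

/-- The complex velocity `-v + i (c - u)`, which is the derivative of the complex potential whose
real part is the stream function. -/
noncomputable def cvel (z : ℂ) : ℂ :=
  -(W.vertSpeed z.re z.im : ℂ) + Complex.I * (W.relSpeed z.re z.im : ℂ)

theorem cvel_continuous : Continuous W.cvel := by
  have h1 : Continuous fun z : ℂ => W.vertSpeed z.re z.im :=
    W.vertSpeed_continuous.comp (Complex.continuous_re.prodMk Complex.continuous_im)
  have h2 : Continuous fun z : ℂ => W.relSpeed z.re z.im :=
    W.relSpeed_continuous.comp (Complex.continuous_re.prodMk Complex.continuous_im)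
  unfold cvel
  fun_prop

theorem cvel_re (z : ℂ) : (W.cvel z).re = -W.vertSpeed z.re z.im := by simp [cvel]

theorem cvel_im (z : ℂ) : (W.cvel z).im = W.relSpeed z.re z.im := by simp [cvel]

theorem cvel_ne_zero (z : ℂ) : W.cvel z ≠ 0 := by
  intro h
  have := W.cvel_im z
  rw [h, Complex.zero_im] at this
  exact (W.relSpeed_pos _ _).ne this

theorem normSq_cvel (z : ℂ) :
    ‖W.cvel z‖ ^ 2 = W.relSpeed z.re z.im ^ 2 + W.vertSpeed z.re z.im ^ 2 := by
  rw [← Complex.normSq_eq_norm_sq, Complex.normSq_apply, cvel_re, cvel_im]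
  ring

theorem relSpeed_le_norm_cvel (z : ℂ) : W.relSpeed z.re z.im ≤ ‖W.cvel z‖ := by
  rw [← cvel_im]
  exact (le_abs_self _).trans (Complex.abs_im_le_norm _)

theorem isOpen_fluidDomain : IsOpen (fluidDomain W.η) :=
  isOpen_lt continuous_snd (W.η_continuous.comp continuous_fst)

theorem cvel_differentiableAt {z : ℂ} (hz : z ∈ W.fluid) : DifferentiableAt ℂ W.cvel z := by
  have hmem : fluidDomain W.η ∈ 𝓝 (z.re, z.im) := W.isOpen_fluidDomain.mem_nhds hz
  have hu := ((W.u_contDiffOn.contDiffAt hmem).differentiableAt one_ne_zero).hasFDerivAt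
  have hv := ((W.v_contDiffOn.contDiffAt hmem).differentiableAt one_ne_zero).hasFDerivAt
  set Lu := fderiv ℝ (Function.uncurry W.u) (z.re, z.im)
  set Lv := fderiv ℝ (Function.uncurry W.v) (z.re, z.im)
  have hx : HasDerivAt (fun s : ℝ => (s, z.im)) ((1, 0) : ℝ × ℝ) z.re :=
    (hasDerivAt_id _).prodMk (hasDerivAt_const _ _)
  have hy : HasDerivAt (fun s : ℝ => (z.re, s)) ((0, 1) : ℝ × ℝ) z.im :=
    (hasDerivAt_const _ _).prodMk (hasDerivAt_id _)
  have hux : deriv (fun s => W.u s z.im) z.re = Lu (1, 0) :=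
    (HasFDerivAt.comp_hasDerivAt (l := Function.uncurry W.u) z.re hu hx).deriv
  have huy : deriv (fun s => W.u z.re s) z.im = Lu (0, 1) :=
    (HasFDerivAt.comp_hasDerivAt (l := Function.uncurry W.u) z.im hu hy).deriv
  have hvx : deriv (fun s => W.v s z.im) z.re = Lv (1, 0) :=
    (HasFDerivAt.comp_hasDerivAt (l := Function.uncurry W.v) z.re hv hx).deriv
  have hvy : deriv (fun s => W.v z.re s) z.im = Lv (0, 1) :=
    (HasFDerivAt.comp_hasDerivAt (l := Function.uncurry W.v) z.im hv hy).deriv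
  have hmass := W.mass_conservation _ _ hz
  have hirr := W.irrotational _ _ hz
  rw [hux, hvy] at hmass
  rw [huy, hvx] at hirr
  have he : HasFDerivAt (fun w : ℂ => (w.re, w.im))
      (Complex.reCLM.prod Complex.imCLM : ℂ →L[ℝ] ℝ × ℝ) z :=
    Complex.reCLM.hasFDerivAt.prodMk Complex.imCLM.hasFDerivAt
  have hU : HasFDerivAt (fun w : ℂ => ((W.u w.re w.im : ℝ) : ℂ))
      (Complex.ofRealCLM.comp (Lu.comp (Complex.reCLM.prod Complex.imCLM))) z :=
    Complex.ofRealCLM.hasFDerivAt.comp z (HasFDerivAt.comp z (g := Function.uncurry W.u) hu he)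
  have hV : HasFDerivAt (fun w : ℂ => ((W.v w.re w.im : ℝ) : ℂ))
      (Complex.ofRealCLM.comp (Lv.comp (Complex.reCLM.prod Complex.imCLM))) z :=
    Complex.ofRealCLM.hasFDerivAt.comp z (HasFDerivAt.comp z (g := Function.uncurry W.v) hv he)
  have hF := hV.neg.add ((hU.const_sub (W.c : ℂ)).const_mul Complex.I)
  have hd : DifferentiableAt ℂ (fun w : ℂ => -((W.v w.re w.im : ℝ) : ℂ) +
      Complex.I * ((W.c : ℂ) - ((W.u w.re w.im : ℝ) : ℂ))) z := by
    rw [differentiableAt_complex_iff_differentiableAt_real]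
    refine ⟨hF.differentiableAt, ?_⟩
    erw [hF.fderiv]
    apply Complex.ext
    · simp
      linarith
    · simp
      linarith
  refine hd.congr_of_eventuallyEq ?_
  filter_upwards [W.isOpen_fluid.mem_nhds hz] with w hw
  have hw' : w.im ≤ W.η w.re := le_of_lt hw
  rw [cvel, relSpeed_of_le hw', vertSpeed_of_le hw']
  push_cast
  rfl

open Complex in
/-- Integration of the complex velocity along horizontal segments of depth `b` and then along
vertical ones. -/
theorem hasDerivAt_wedge {b : ℝ} (hb : ∀ x, b < W.η x) {z : ℂ} (hz : z ∈ W.fluid) :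
    HasDerivAt (fun w => wedgeIntegral (b * I) w W.cvel) (W.cvel z) z := by
  obtain ⟨r, hr, hball⟩ := Metric.isOpen_iff.1 W.isOpen_fluid z hz
  have hdiff : DifferentiableOn ℂ W.cvel (Metric.ball z r) := fun w hw =>
    (W.cvel_differentiableAt (hball hw)).differentiableWithinAt
  have hloc := hdiff.isConservativeOn.hasDerivAt_wedgeIntegral W.cvel_continuous.continuousOn
    (Metric.mem_ball_self hr)
  refine (hloc.const_add (wedgeIntegral (b * I) z W.cvel)).congr_of_eventuallyEq ?_
  have hnear : ∀ᶠ x in 𝓝 z.re, max b z.im < W.η x :=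
    W.η_continuous.continuousAt.eventually_const_lt (max_lt (hb _) hz)
  obtain ⟨ε, hε, hnear⟩ := Metric.eventually_nhds_iff_ball.1 hnear
  have hev : ∀ᶠ w : ℂ in 𝓝 z, w.re ∈ Metric.ball z.re ε :=
    continuous_re.continuousAt.eventually (Metric.ball_mem_nhds _ hε)
  filter_upwards [hev] with w hw
  -- Cauchy's theorem on the rectangle between depth `b` and the height of `z`, over the segment
  -- from `z.re` to `w.re`. It lies in the fluid because near `z.re` the surface is above both
  -- heights. This makes the integral from `b * I` differ from the local one based at `z` by a
  -- constant.
  have hrect := integral_boundary_rect_eq_zero_of_differentiableOn W.cvel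
    (z.re + b * I) (w.re + z.im * I) (fun p hp => by
      refine (W.cvel_differentiableAt ?_).differentiableWithinAt
      simp only [mem_reProdIm, add_re, ofReal_re, mul_re, I_re, mul_zero, ofReal_im, I_im, mul_one,
        sub_self, add_zero, add_im, mul_im, zero_add] at hp
      have h1 : p.re ∈ Metric.ball z.re ε := by
        have := (convex_ball z.re ε).ordConnected.uIcc_subset (Metric.mem_ball_self hε) hw
        exact this hp.1
      have h2 : p.im ≤ max b z.im := hp.2.2
      exact h2.trans_lt (hnear _ h1))
  have hi : ∀ y s t : ℝ, IntervalIntegrable (fun x : ℝ => W.cvel (x + y * I))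
      MeasureTheory.volume s t := fun y s t =>
    (W.cvel_continuous.comp (by fun_prop)).intervalIntegrable _ _
  have hi' : ∀ x s t : ℝ, IntervalIntegrable (fun y : ℝ => W.cvel (x + y * I))
      MeasureTheory.volume s t := fun y s t =>
    (W.cvel_continuous.comp (by fun_prop)).intervalIntegrable _ _
  simp only [add_re, ofReal_re, mul_re, I_re, mul_zero, ofReal_im, I_im, mul_one,
    sub_self, add_zero, add_im, mul_im, zero_add, smul_eq_mul] at hrect
  simp only [wedgeIntegral, ofReal_re, mul_re, I_re, mul_zero, ofReal_im, I_im, mul_one,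
    sub_self, add_zero, mul_im, smul_eq_mul]
  rw [← intervalIntegral.integral_add_adjacent_intervals (hi b 0 z.re) (hi b z.re w.re),
    ← intervalIntegral.integral_add_adjacent_intervals (hi' w.re b z.im) (hi' w.re z.im w.im)]
  linear_combination hrect

open Complex in
-- The path of integration ends with a vertical segment, so the vertical derivative needs only
-- continuity of `cvel` and holds on and above the surface too. The complex derivative is confined
-- to the fluid.
theorem exists_potential_aux : ∃ ζ : ℂ → ℂ, Continuous ζ ∧
    (∀ x y : ℝ, HasDerivAt (fun s : ℝ => ζ (x + s * I)) (I * W.cvel (x + y * I)) y) ∧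
    ∀ z ∈ W.fluid, HasDerivAt ζ (W.cvel z) z := by
  obtain ⟨b, hb⟩ := W.exists_depth
  refine ⟨fun w => wedgeIntegral (b * I) w W.cvel, ?_, fun x y => ?_,
    fun z hz => W.hasDerivAt_wedge hb hz⟩
  · simp only [wedgeIntegral]
    refine Continuous.add ?_ (Continuous.const_smul ?_ I)
    · exact intervalIntegral.continuous_parametric_intervalIntegral_of_continuous
        (f := fun (_ : ℂ) (x : ℝ) => W.cvel (x + ((b * I : ℂ).im : ℂ) * I))
        (W.cvel_continuous.comp (by fun_prop)) continuous_re
    · exact intervalIntegral.continuous_parametric_intervalIntegral_of_continuous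
        (f := fun (z : ℂ) (y : ℝ) => W.cvel (z.re + y * I))
        (W.cvel_continuous.comp (by fun_prop)) continuous_im
  · have hc : Continuous fun s : ℝ => W.cvel (x + s * I) := W.cvel_continuous.comp (by fun_prop)
    have := ((hc.integral_hasStrictDerivAt b y).hasDerivAt.const_mul I).const_add
      (∫ s : ℝ in (0 : ℝ)..x, W.cvel (s + b * I))
    simpa [wedgeIntegral] using this

open Complex in
/-- The surface is a streamline. -/
theorem re_potential_surface {ζ : ℂ → ℂ} (hc : Continuous ζ)
    (hd : ∀ z ∈ W.fluid, HasDerivAt ζ (W.cvel z) z) (a b : ℝ) :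
    (ζ (b + W.η b * I)).re = (ζ (a + W.η a * I)).re := by
  -- The surface lowered by `e`: for e > 0 it runs in the fluid, where the chain rule applies, and
  -- then e → 0.
  let S : ℝ → ℝ → ℂ := fun e x => x + ((W.η x - e : ℝ) : ℂ) * I
  have hη := W.η_continuous
  have hη' : Continuous (deriv W.η) := W.η_contDiff.continuous_deriv le_rfl
  have hS : Continuous (Function.uncurry S) := by
    simp only [S, Function.uncurry_def]
    fun_prop
  let k : ℝ → ℝ → ℝ := fun e x => (W.cvel (S e x) * (1 + deriv W.η x * I)).re
  have hk : Continuous (Function.uncurry k) := by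
    have h1 : Continuous fun z : ℝ × ℝ => W.cvel (S z.1 z.2) := W.cvel_continuous.comp hS
    exact continuous_re.comp (h1.mul (by fun_prop))
  have hpos : ∀ e : ℝ, 0 < e → ∫ x in a..b, k e x = (ζ (S e b)).re - (ζ (S e a)).re := by
    intro e he
    refine intervalIntegral.integral_eq_sub_of_hasDerivAt (f := fun x => (ζ (S e x)).re)
      (fun x _ => ?_) ((hk.comp (Continuous.prodMk_right e)).intervalIntegrable _ _)
    have hSx : HasDerivAt (S e) (1 + deriv W.η x * I) x := by
      have h1 : HasDerivAt (fun s : ℝ => (s : ℂ)) 1 x := (hasDerivAt_id x).ofReal_comp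
      exact h1.add ((((W.η_hasDerivAt x).sub_const e).ofReal_comp).mul_const I)
    have hmem : S e x ∈ W.fluid := by
      simp only [fluid, mem_ofPred_eq, S]
      simp [he]
    exact (reCLM.hasFDerivAt.comp_hasDerivAt x ((hd _ hmem).comp x hSx))
  have hlim1 : Tendsto (fun e => ∫ x in a..b, k e x) (𝓝[>] 0) (𝓝 (∫ x in a..b, k 0 x)) :=
    ((intervalIntegral.continuous_parametric_intervalIntegral_of_continuous' hk a b).tendsto 0
      ).mono_left nhdsWithin_le_nhds
  have hlim2 : Tendsto (fun e => (ζ (S e b)).re - (ζ (S e a)).re) (𝓝[>] 0)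
      (𝓝 ((ζ (S 0 b)).re - (ζ (S 0 a)).re)) := by
    refine Tendsto.mono_left (Continuous.tendsto ?_ 0) nhdsWithin_le_nhds
    have : ∀ x, Continuous fun e => S e x := fun x => hS.comp (Continuous.prodMk_left x)
    exact (continuous_re.comp (hc.comp (this b))).sub (continuous_re.comp (hc.comp (this a)))
  have heq := tendsto_nhds_unique (hlim1.congr' (by
    filter_upwards [self_mem_nhdsWithin] with e he using hpos e he)) hlim2
  -- The kinematic condition: the relative velocity is tangent to the surface.
  have hk0 : ∀ x, k 0 x = 0 := by
    intro x
    have hkin := W.kinematic x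
    simp only [k, S, mul_re, cvel_re, cvel_im, add_re, add_im, one_re, one_im, ofReal_re, ofReal_im,
      I_re, I_im, mul_im]
    simp only [sub_zero, mul_zero, add_zero, mul_one, zero_add]
    rw [vertSpeed_of_le le_rfl, relSpeed_of_le le_rfl, hkin]
    ring
  simp only [hk0, intervalIntegral.integral_zero, S, sub_zero] at heq
  linarith

open Complex in
theorem exists_potential : ∃ ζ : ℂ → ℂ, Continuous ζ ∧
    (∀ x y : ℝ, HasDerivAt (fun s : ℝ => ζ (x + s * I)) (I * W.cvel (x + y * I)) y) ∧
    (∀ z ∈ W.fluid, HasDerivAt ζ (W.cvel z) z) ∧ ∀ x : ℝ, (ζ (x + W.η x * I)).re = 0 := by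
  obtain ⟨ζ, hc, hy, hd⟩ := W.exists_potential_aux
  refine ⟨fun z => ζ z - ζ ((0 : ℝ) + W.η 0 * I), hc.sub continuous_const,
    fun x y => (hy x y).sub_const _, fun z hz => (hd z hz).sub_const _, fun x => ?_⟩
  rw [sub_re, W.re_potential_surface hc hd 0 x, sub_self]

/-- The complex potential, whose real part is the stream function and whose imaginary part is the
negative of the velocity potential of the flow in the moving frame. -/
noncomputable def potential : ℂ → ℂ := W.exists_potential.choose

theorem potential_continuous : Continuous W.potential := W.exists_potential.choose_spec.1

open Complex in
theorem potential_hasDerivAt_vert (x y : ℝ) :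
    HasDerivAt (fun s : ℝ => W.potential (x + s * I)) (I * W.cvel (x + y * I)) y :=
  W.exists_potential.choose_spec.2.1 x y

theorem potential_hasDerivAt {z : ℂ} (hz : z ∈ W.fluid) :
    HasDerivAt W.potential (W.cvel z) z :=
  W.exists_potential.choose_spec.2.2.1 z hz

open Complex in
theorem potential_re_surface (x : ℝ) : (W.potential (x + W.η x * I)).re = 0 :=
  W.exists_potential.choose_spec.2.2.2 x

/-- The stream function, continued above the surface. -/
noncomputable def stream (x y : ℝ) : ℝ := (W.potential (x + y * Complex.I)).re

/-- The negative of the velocity potential of the flow in the moving frame. -/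
noncomputable def velPot (x y : ℝ) : ℝ := (W.potential (x + y * Complex.I)).im

theorem stream_continuous : Continuous (Function.uncurry W.stream) :=
  Complex.continuous_re.comp (W.potential_continuous.comp (by fun_prop))

theorem velPot_continuous : Continuous (Function.uncurry W.velPot) :=
  Complex.continuous_im.comp (W.potential_continuous.comp (by fun_prop))

theorem stream_hasDerivAt_vert (x y : ℝ) :
    HasDerivAt (fun s => W.stream x s) (-W.relSpeed x y) y := by
  have := Complex.reCLM.hasFDerivAt.comp_hasDerivAt y (W.potential_hasDerivAt_vert x y)
  refine this.congr_deriv ?_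
  simp [cvel_im]

theorem velPot_hasDerivAt_vert (x y : ℝ) :
    HasDerivAt (fun s => W.velPot x s) (-W.vertSpeed x y) y := by
  have := Complex.imCLM.hasFDerivAt.comp_hasDerivAt y (W.potential_hasDerivAt_vert x y)
  refine this.congr_deriv ?_
  simp [cvel_re]

theorem stream_surface (x : ℝ) : W.stream x (W.η x) = 0 := W.potential_re_surface x

/-- The complex potential along a differentiable curve in the fluid. -/
theorem potential_comp_hasDerivAt {X Y : ℝ → ℝ} {X' Y' t : ℝ} (hX : HasDerivAt X X' t)
    (hY : HasDerivAt Y Y' t) (h : Y t < W.η (X t)) :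
    HasDerivAt (fun s => W.potential (X s + Y s * Complex.I))
      (W.cvel (X t + Y t * Complex.I) * (X' + Y' * Complex.I)) t :=
  HasDerivAt.comp t (W.potential_hasDerivAt (z := X t + Y t * Complex.I) (by simpa [fluid] using h))
    (hX.ofReal_comp.add (hY.ofReal_comp.mul_const Complex.I))

theorem stream_comp_hasDerivAt {X Y : ℝ → ℝ} {X' Y' t : ℝ} (hX : HasDerivAt X X' t)
    (hY : HasDerivAt Y Y' t) (h : Y t < W.η (X t)) :
    HasDerivAt (fun s => W.stream (X s) (Y s))
      (-W.vertSpeed (X t) (Y t) * X' - W.relSpeed (X t) (Y t) * Y') t := by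
  refine (Complex.reCLM.hasFDerivAt.comp_hasDerivAt t
    (W.potential_comp_hasDerivAt hX hY h)).congr_deriv ?_
  simp [cvel_im, cvel_re]

theorem velPot_comp_hasDerivAt {X Y : ℝ → ℝ} {X' Y' t : ℝ} (hX : HasDerivAt X X' t)
    (hY : HasDerivAt Y Y' t) (h : Y t < W.η (X t)) :
    HasDerivAt (fun s => W.velPot (X s) (Y s))
      (W.relSpeed (X t) (Y t) * X' - W.vertSpeed (X t) (Y t) * Y') t := by
  refine (Complex.imCLM.hasFDerivAt.comp_hasDerivAt t
    (W.potential_comp_hasDerivAt hX hY h)).congr_deriv ?_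
  simp [cvel_im, cvel_re]
  ring

theorem stream_isStreamFunction : W.IsStreamFunction W.stream where
  continuousOn := W.stream_continuous.continuousOn
  hasDerivAt_x x y h := by
    have := W.stream_comp_hasDerivAt (hasDerivAt_id x) (hasDerivAt_const x y) h
    simpa [vertSpeed_of_le h.le] using this
  hasDerivAt_y x y h := by
    have := W.stream_hasDerivAt_vert x y
    simpa [relSpeed_of_le h.le] using this
  surface := W.stream_surface

variable {W} in
-- On a vertical segment up to the surface, both functions have the same derivative in the fluid and
-- vanish at the top.
theorem IsStreamFunction.eq_stream {ψ : ℝ → ℝ → ℝ} (hψ : W.IsStreamFunction ψ) {x y : ℝ}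
    (h : y ≤ W.η x) : ψ x y = W.stream x y := by
  have hcont : ContinuousOn (fun s => ψ x s - W.stream x s) (Icc y (W.η x)) := by
    refine ContinuousOn.sub ?_ (W.stream_continuous.comp (Continuous.prodMk_right x)).continuousOn
    exact hψ.continuousOn.comp (Continuous.prodMk_right x).continuousOn fun s hs => hs.2
  have hconst := constant_of_has_deriv_right_zero (f := fun s => ψ x s - W.stream x s) hcont
    (fun s hs => by
      have := (hψ.hasDerivAt_y x s hs.2).sub (W.stream_isStreamFunction.hasDerivAt_y x s hs.2)
      rw [sub_self] at this
      exact this.hasDerivWithinAt) (W.η x) (right_mem_Icc.2 h)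
  simp only [hψ.surface, W.stream_surface, sub_self] at hconst
  linarith

end DeepWaterStokesWave

/-! ### Streamlines as graphs -/

/-- A continuous function whose derivative vanishes wherever the function does not is constant. -/
theorem eq_of_hasDerivAt_zero_of_ne_zero {q : ℝ → ℝ} (hq : Continuous q)
    (hd : ∀ t, q t ≠ 0 → HasDerivAt q 0 t) (s t : ℝ) : q s = q t := by
  have key : ∀ s t, q s ≠ 0 → q t = q s := by
    intro s t hs
    have hclopen : IsClopen {t | q t = q s} := by
      refine ⟨isClosed_eq hq continuous_const, ?_⟩
      rw [Metric.isOpen_iff]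
      intro a (ha : q a = q s)
      have hne : ∀ᶠ b in 𝓝 a, q b ≠ 0 := hq.continuousAt.eventually_ne (ha ▸ hs)
      obtain ⟨ε, hε, hne⟩ := Metric.eventually_nhds_iff_ball.1 hne
      refine ⟨ε, hε, fun b hb => ?_⟩
      have := (convex_ball a ε).is_const_of_fderivWithin_eq_zero (𝕜 := ℝ) (f := q)
        (fun c hc => (hd c (hne c hc)).differentiableAt.differentiableWithinAt)
        (fun c hc => by
          rw [fderivWithin_of_isOpen Metric.isOpen_ball hc]
          ext
          simpa using (hd c (hne c hc)).deriv) hb (Metric.mem_ball_self hε)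
      exact this.trans ha
    have := hclopen.eq_univ ⟨s, rfl⟩
    exact (this ▸ mem_univ t : t ∈ {t | q t = q s})
  by_cases hs : q s = 0
  · by_cases ht : q t = 0
    · rw [hs, ht]
    · exact key t s ht
  · exact (key s t hs).symm

namespace DeepWaterStokesWave

variable (W : DeepWaterStokesWave)

theorem exists_stream_growth : ∃ δ : ℝ, 0 < δ ∧
    ∀ x a b, a ≤ b → δ * (b - a) ≤ W.stream x a - W.stream x b := by
  obtain ⟨δ, K, hδ, h⟩ := W.exists_relSpeed_bounds
  refine ⟨δ, hδ, fun x a b hab => ?_⟩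
  have hd : ∀ y, HasDerivAt (fun s => -W.stream x s) (W.relSpeed x y) y := fun y => by
    simpa using (W.stream_hasDerivAt_vert x y).fun_neg
  have := mul_sub_le_image_sub_of_le_deriv (fun y => (hd y).differentiableAt)
    (fun y => (hd y).deriv ▸ (h x y).1) hab
  linarith

theorem stream_strictAnti (x : ℝ) : StrictAnti (W.stream x) := by
  obtain ⟨δ, hδ, h⟩ := W.exists_stream_growth
  intro a b hab
  have := h x a b hab.le
  nlinarith [mul_pos hδ (sub_pos.2 hab)]

theorem exists_height : ∃ h : ℝ → ℝ → ℝ, Continuous (Function.uncurry h) ∧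
    (∀ x p, W.stream x (h x p) = p) ∧ ∀ x y, h x (W.stream x y) = y := by
  obtain ⟨δ, hδ, hg⟩ := W.exists_stream_growth
  obtain ⟨r, hr, h1, h2⟩ := exists_continuous_fiberwise_inverse (G := fun x y => -W.stream x y)
    W.stream_continuous.neg hδ (fun x a b hab => by linarith [hg x a b hab])
  refine ⟨fun x p => r x (-p), hr.comp (continuous_fst.prodMk continuous_snd.neg),
    fun x p => ?_, fun x y => h2 x y⟩
  have := h1 x (-p)
  linarith

/-- The height of the streamline `p` above `x`. -/
noncomputable def height (x p : ℝ) : ℝ := W.exists_height.choose x p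

theorem height_continuous : Continuous (Function.uncurry W.height) :=
  W.exists_height.choose_spec.1

@[simp] theorem stream_height (x p : ℝ) : W.stream x (W.height x p) = p :=
  W.exists_height.choose_spec.2.1 x p

@[simp] theorem height_stream (x y : ℝ) : W.height x (W.stream x y) = y :=
  W.exists_height.choose_spec.2.2 x y

theorem height_zero (x : ℝ) : W.height x 0 = W.η x := by
  rw [← W.stream_surface x, height_stream]

theorem height_strictAnti (x : ℝ) : StrictAnti (W.height x) := fun p q hpq =>
  (W.stream_strictAnti x).lt_iff_gt.1 (by simpa using hpq)

variable {W} in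
theorem height_le {p : ℝ} (hp : 0 ≤ p) (x : ℝ) : W.height x p ≤ W.η x :=
  W.height_zero x ▸ (W.height_strictAnti x).antitone hp

variable {W} in
theorem height_lt {p : ℝ} (hp : 0 < p) (x : ℝ) : W.height x p < W.η x :=
  W.height_zero x ▸ W.height_strictAnti x hp

variable {W} in
theorem stream_nonneg {x y : ℝ} (h : y ≤ W.η x) : 0 ≤ W.stream x y :=
  W.stream_surface x ▸ (W.stream_strictAnti x).antitone h

theorem stream_add_lam (x y : ℝ) : W.stream (x + W.lam) y = W.stream x y := by
  have hd : ∀ s, HasDerivAt (fun s => W.stream (x + W.lam) s - W.stream x s) 0 s := fun s => by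
    refine ((W.stream_hasDerivAt_vert _ s).sub (W.stream_hasDerivAt_vert x s)).congr_deriv ?_
    rw [relSpeed_add_lam]
    ring
  have := is_const_of_deriv_eq_zero (fun s => (hd s).differentiableAt) (fun s => (hd s).deriv)
    y (W.η x)
  simp only [W.stream_surface] at this
  rw [← W.η_periodic x, W.stream_surface] at this
  linarith

theorem height_add_lam (x p : ℝ) : W.height (x + W.lam) p = W.height x p := by
  have := W.stream_add_lam x (W.height x p)
  rw [stream_height] at this
  nth_rw 1 [← this]
  rw [height_stream]

variable {W} in
-- For p = 0 this is the kinematic condition. For p > 0 it is implicit differentiation: on the line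
-- with the expected slope the stream function deviates from p by o(s - x), and its growth rate δ in
-- y turns this into the same estimate for the height.
theorem height_hasDerivAt {p : ℝ} (hp : 0 ≤ p) (x : ℝ) :
    HasDerivAt (fun s => W.height s p)
      (-W.vertSpeed x (W.height x p) / W.relSpeed x (W.height x p)) x := by
  rcases hp.eq_or_lt with rfl | hp
  · simp only [height_zero]
    refine (W.η_hasDerivAt x).congr_deriv ?_
    have hkin := W.kinematic x
    rw [eq_div_iff (W.relSpeed_pos _ _).ne', relSpeed_of_le le_rfl, vertSpeed_of_le le_rfl, hkin]
    ring
  · obtain ⟨δ, hδ, hg⟩ := W.exists_stream_growth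
    set h₀ := W.height x p
    set m := -W.vertSpeed x h₀ / W.relSpeed x h₀ with hm
    have hline : HasDerivAt (fun s => h₀ + (s - x) * m) m x := by
      simpa using (((hasDerivAt_id x).sub_const x).mul_const m).const_add h₀
    have hk : HasDerivAt (fun s => W.stream s (h₀ + (s - x) * m)) 0 x := by
      refine (W.stream_comp_hasDerivAt (hasDerivAt_id x) hline ?_).congr_deriv ?_
      · simpa using height_lt hp x
      · have := (W.relSpeed_pos x h₀).ne'
        simp only [id, sub_self, zero_mul, add_zero, hm]
        field_simp
        ring
    rw [hasDerivAt_iff_isLittleO] at hk ⊢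
    refine Asymptotics.IsBigO.trans_isLittleO ?_ hk
    refine Asymptotics.IsBigO.of_bound δ⁻¹ (Eventually.of_forall fun s => ?_)
    have hx : W.stream x h₀ = p := W.stream_height x p
    have hs : W.stream s (W.height s p) = p := W.stream_height s p
    simp only [sub_self, zero_mul, add_zero, smul_eq_mul, mul_zero, sub_zero, Real.norm_eq_abs, hx]
    rw [inv_mul_eq_div, le_div_iff₀ hδ, mul_comm]
    set y := h₀ + (s - x) * m with hy
    have e : W.height s p - h₀ - (s - x) * m = W.height s p - y := by rw [hy]; ring
    rw [e]
    rcases le_total (W.height s p) y with h | h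
    · have h1 := hg s _ _ h
      rw [hs] at h1
      rw [abs_sub_comm, abs_of_nonneg (sub_nonneg.2 h), abs_sub_comm]
      exact h1.trans (le_abs_self _)
    · have h1 := hg s _ _ h
      rw [hs] at h1
      rw [abs_of_nonneg (sub_nonneg.2 h)]
      exact h1.trans (le_abs_self _)

/-- The horizontal speed along the streamline `p`. -/
noncomputable def lineSpeed (p x : ℝ) : ℝ := W.relSpeed x (W.height x p)

theorem lineSpeed_pos (p x : ℝ) : 0 < W.lineSpeed p x := W.relSpeed_pos _ _

theorem lineSpeed_continuous : Continuous (Function.uncurry W.lineSpeed) :=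
  W.relSpeed_continuous.comp
    (continuous_snd.prodMk (W.height_continuous.comp continuous_swap))

theorem slowness_continuous (p : ℝ) : Continuous fun x => 1 / W.lineSpeed p x :=
  continuous_const.div (W.lineSpeed_continuous.comp (Continuous.prodMk_right p))
    fun x => (W.lineSpeed_pos p x).ne'

theorem lineSpeed_periodic (p : ℝ) : Function.Periodic (W.lineSpeed p) W.lam := by
  intro x
  rw [lineSpeed, height_add_lam, relSpeed_add_lam, lineSpeed]

/-! ### Travel times and particle paths -/

/-- The time a particle on the streamline `p` needs to get from `x` to `0`. -/
noncomputable def travelTime (p x : ℝ) : ℝ := ∫ s in (0 : ℝ)..x, 1 / W.lineSpeed p s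

/-- The streamline time-period. -/
noncomputable def period (p : ℝ) : ℝ :=
  ∫ s in (-(W.lam / 2))..(W.lam / 2), 1 / W.lineSpeed p s

theorem travelTime_hasDerivAt (p x : ℝ) :
    HasDerivAt (W.travelTime p) (1 / W.lineSpeed p x) x :=
  ((W.slowness_continuous p).integral_hasStrictDerivAt 0 x).hasDerivAt

theorem travelTime_strictMono (p : ℝ) : StrictMono (W.travelTime p) :=
  strictMono_of_hasDerivAt_pos (W.travelTime_hasDerivAt p)
    fun x => one_div_pos.2 (W.lineSpeed_pos p x)

theorem integral_slowness_eq_period (p x : ℝ) :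
    ∫ s in x..x + W.lam, 1 / W.lineSpeed p s = W.period p := by
  have hper : Function.Periodic (fun s => 1 / W.lineSpeed p s) W.lam := fun s => by
    simp only [W.lineSpeed_periodic p s]
  rw [hper.intervalIntegral_add_eq x (-(W.lam / 2)), period]
  congr 1
  ring

theorem travelTime_sub_lam (p x : ℝ) :
    W.travelTime p (x - W.lam) = W.travelTime p x - W.period p := by
  have h := intervalIntegral.integral_add_adjacent_intervals
    ((W.slowness_continuous p).intervalIntegrable (μ := MeasureTheory.volume) 0 (x - W.lam))
    ((W.slowness_continuous p).intervalIntegrable (x - W.lam) x)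
  have h' := W.integral_slowness_eq_period p (x - W.lam)
  rw [sub_add_cancel] at h'
  rw [h'] at h
  unfold travelTime
  linarith

theorem period_pos (p : ℝ) : 0 < W.period p := by
  have := W.travelTime_strictMono p (sub_lt_self 0 W.lam_pos)
  rw [travelTime_sub_lam] at this
  linarith

/-- The motion along a streamline is a scalar autonomous equation, solved by inverting its travel
time. The slope of the latter is at least 1/K, so the inverse is defined for all times. -/
theorem exists_travelTime_inverse (p : ℝ) : ∃ r : ℝ → ℝ,
    (∀ τ, HasDerivAt r (W.lineSpeed p (r τ)) τ) ∧ ∀ x, r (W.travelTime p x) = x := by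
  obtain ⟨δ, K, hδ, hb⟩ := W.exists_relSpeed_bounds
  have hK : 0 < K := hδ.trans_le ((hb 0 0).1.trans (hb 0 0).2)
  have hcont : Continuous (W.travelTime p) :=
    continuous_iff_continuousAt.2 fun x => (W.travelTime_hasDerivAt p x).continuousAt
  obtain ⟨r, hr, h1, h2⟩ := exists_continuous_fiberwise_inverse
    (G := fun (_ : Unit) x => W.travelTime p x) (hcont.comp continuous_snd) (one_div_pos.2 hK)
    (fun _ a b hab => mul_sub_le_image_sub_of_le_deriv
      (fun y => (W.travelTime_hasDerivAt p y).differentiableAt)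
      (fun y => by
        rw [(W.travelTime_hasDerivAt p y).deriv]
        exact one_div_le_one_div_of_le (W.lineSpeed_pos p y) (hb _ _).2) hab)
  refine ⟨r (), fun τ => ?_, h2 ()⟩
  have hc : Continuous (r ()) := hr.comp (Continuous.prodMk_right ())
  have := HasDerivAt.of_local_left_inverse hc.continuousAt (W.travelTime_hasDerivAt p (r () τ))
    (one_div_pos.2 (W.lineSpeed_pos p _)).ne' (Eventually.of_forall (h1 ()))
  simpa using this

theorem exists_particlePath {t₀ x₀ y₀ : ℝ} (h : y₀ ≤ W.η (x₀ - W.c * t₀)) :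
    ∃ X Y : ℝ → ℝ, W.IsParticlePath X Y ∧ X t₀ = x₀ ∧ Y t₀ = y₀ := by
  set ξ := x₀ - W.c * t₀ with hξ
  set p := W.stream ξ y₀ with hp
  have hp0 : 0 ≤ p := stream_nonneg h
  obtain ⟨r, hr, hinv⟩ := W.exists_travelTime_inverse p
  let x : ℝ → ℝ := fun t => r (W.travelTime p ξ - (t - t₀))
  have hx : ∀ t, HasDerivAt x (-W.lineSpeed p (x t)) t := fun t => by
    have h1 : HasDerivAt (fun t => W.travelTime p ξ - (t - t₀)) (-1) t := by
      simpa using ((hasDerivAt_id t).sub_const t₀).const_sub (W.travelTime p ξ)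
    simpa using! (hr _).comp t h1
  have hx0 : x t₀ = ξ := by simp [x, hinv]
  have hle : ∀ t, W.height (x t) p ≤ W.η (x t) := fun t => height_le hp0 _
  refine ⟨fun t => x t + W.c * t, fun t => W.height (x t) p, ⟨fun t => ?_, fun t => ?_, fun t => ?_⟩,
    ?_, ?_⟩
  · simpa using hle t
  · have h1 : HasDerivAt (fun t => W.c * t) W.c t := by
      simpa using (hasDerivAt_id t).const_mul W.c
    refine ((hx t).add h1).congr_deriv ?_
    simp only [add_sub_cancel_right, lineSpeed, relSpeed_of_le (hle t)]
    ring
  · refine ((height_hasDerivAt hp0 (x t)).comp t (hx t)).congr_deriv ?_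
    simp only [add_sub_cancel_right]
    rw [← vertSpeed_of_le (hle t), lineSpeed]
    have := (W.relSpeed_pos (x t) (W.height (x t) p)).ne'
    field_simp
  · simp only [hx0, hξ, sub_add_cancel]
  · simp only [hx0, hp, height_stream]

variable {W} in
theorem IsParticlePath.hasDerivAt_moving {X Y : ℝ → ℝ} (h : W.IsParticlePath X Y) (t : ℝ) :
    HasDerivAt (fun t => X t - W.c * t) (-W.relSpeed (X t - W.c * t) (Y t)) t := by
  have h1 : HasDerivAt (fun t => W.c * t) W.c t := by
    simpa using (hasDerivAt_id t).const_mul W.c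
  refine ((h.hasDerivAt_X t).sub h1).congr_deriv ?_
  rw [relSpeed_of_le (h.mem_fluid t)]
  ring

variable {W} in
/-- Particles stay on their streamlines. -/
theorem IsParticlePath.stream_eq {X Y : ℝ → ℝ} (h : W.IsParticlePath X Y) (s t : ℝ) :
    W.stream (X s - W.c * s) (Y s) = W.stream (X t - W.c * t) (Y t) := by
  have hX : Continuous fun t => X t - W.c * t :=
    continuous_iff_continuousAt.2 fun t => (h.hasDerivAt_moving t).continuousAt
  have hY : Continuous Y := continuous_iff_continuousAt.2 fun t => (h.hasDerivAt_Y t).continuousAt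
  refine eq_of_hasDerivAt_zero_of_ne_zero (q := fun t => W.stream (X t - W.c * t) (Y t))
    (W.stream_continuous.comp (hX.prodMk hY)) (fun t ht => ?_) s t
  -- A nonzero value of the stream function places the particle strictly below the surface, where
  -- the chain rule is available.
  have hlt : Y t < W.η (X t - W.c * t) := by
    refine lt_of_le_of_ne (h.mem_fluid t) fun heq => ht ?_
    simp only [heq, W.stream_surface]
  refine (W.stream_comp_hasDerivAt (h.hasDerivAt_moving t) (h.hasDerivAt_Y t) hlt).congr_deriv ?_
  rw [vertSpeed_of_le hlt.le]
  ring

variable {W} in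
-- The travel time plus t is conserved. This determines the horizontal motion of every path without
-- a uniqueness theorem for the differential equation, for which the velocity need not be regular
-- enough at the surface.
theorem IsParticlePath.travelTime_eq {X Y : ℝ → ℝ} (h : W.IsParticlePath X Y) {p t₀ : ℝ}
    (hp : W.stream (X t₀ - W.c * t₀) (Y t₀) = p) (τ : ℝ) :
    W.travelTime p (X (τ + t₀) - W.c * (τ + t₀)) = W.travelTime p (X t₀ - W.c * t₀) - τ := by
  have hY : ∀ t, W.height (X t - W.c * t) p = Y t := fun t => by
    rw [← hp, h.stream_eq t₀ t, height_stream]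
  have hd : ∀ t, HasDerivAt (fun t => W.travelTime p (X t - W.c * t) + t) 0 t := fun t => by
    refine (((W.travelTime_hasDerivAt p _).comp t (h.hasDerivAt_moving t)).add
      (hasDerivAt_id t)).congr_deriv ?_
    rw [lineSpeed, hY]
    have := (W.relSpeed_pos (X t - W.c * t) (Y t)).ne'
    field_simp
    ring
  have := is_const_of_deriv_eq_zero (fun t => (hd t).differentiableAt) (fun t => (hd t).deriv)
    (τ + t₀) t₀
  linarith

variable {W} in
theorem IsParticlePath.traverses_iff {X Y : ℝ → ℝ} (h : W.IsParticlePath X Y) {p t₀ : ℝ}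
    (hp : W.stream (X t₀ - W.c * t₀) (Y t₀) = p) (τ : ℝ) :
    X (τ + t₀) - W.c * τ = X t₀ - W.lam ↔ τ = W.period p := by
  have h1 : X (τ + t₀) - W.c * τ = X t₀ - W.lam ↔
      X (τ + t₀) - W.c * (τ + t₀) = X t₀ - W.c * t₀ - W.lam := by
    constructor <;> intro h <;> linarith
  rw [h1, ← (W.travelTime_strictMono p).injective.eq_iff, h.travelTime_eq hp, travelTime_sub_lam]
  constructor <;> intro h <;> linarith

theorem isStreamlineTimePeriod_period {p : ℝ} (hp : 0 ≤ p) :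
    W.IsStreamlineTimePeriod W.stream p (W.period p) := by
  refine ⟨?_, fun X Y t₀ h hon τ => ?_⟩
  · obtain ⟨X, Y, h, hX, hY⟩ := W.exists_particlePath (t₀ := 0) (x₀ := 0) (y₀ := W.height 0 p)
      (by simpa using height_le hp 0)
    refine ⟨X, Y, 0, h, ?_⟩
    simp [OnStreamlineAt, hX, hY]
  · rw [h.traverses_iff hon]
    constructor
    · exact fun h => h.2
    · rintro rfl
      exact ⟨W.period_pos p, rfl⟩

variable {W} in
theorem IsParticlePath.add_period {X Y : ℝ → ℝ} (h : W.IsParticlePath X Y) {p t₀ : ℝ}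
    (hp : W.stream (X t₀ - W.c * t₀) (Y t₀) = p) :
    X (W.period p + t₀) = X t₀ + (W.c * W.period p - W.lam) := by
  have := (h.traverses_iff hp (W.period p)).2 rfl
  linarith

variable {W} in
-- On a closed path X would be periodic, hence bounded, whereas at the multiples of the streamline
-- period it grows by a fixed positive drift.
theorem IsParticlePath.not_isClosedPath {X Y : ℝ → ℝ} (h : W.IsParticlePath X Y)
    (hdrift : ∀ p, 0 ≤ p → 0 < W.c * W.period p - W.lam) : ¬ IsClosedPath X Y := by
  rintro ⟨τ, hτ, hcl⟩
  have hper : Function.Periodic X τ := fun t => (hcl t).1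
  set p := W.stream (X 0 - W.c * 0) (Y 0)
  have hp : 0 ≤ p := stream_nonneg (h.mem_fluid 0)
  have hn : ∀ n : ℕ, X (n * W.period p) = X 0 + n * (W.c * W.period p - W.lam) := by
    intro n
    induction n with
    | zero => simp
    | succ k ih =>
      have := h.add_period (p := p) (t₀ := k * W.period p) (h.stream_eq _ _)
      push_cast
      rw [show ((k : ℝ) + 1) * W.period p = W.period p + k * W.period p by ring, this, ih]
      ring
  have hX : Continuous X := continuous_iff_continuousAt.2 fun t => (h.hasDerivAt_X t).continuousAt
  obtain ⟨M, hM⟩ := (isCompact_Icc (a := (0 : ℝ)) (b := τ)).bddAbove_image hX.continuousOn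
  obtain ⟨n, hlt⟩ := exists_nat_gt ((M - X 0) / (W.c * W.period p - W.lam))
  rw [div_lt_iff₀ (hdrift p hp)] at hlt
  obtain ⟨s, hs, hXs⟩ := hper.exists_mem_Ico₀ hτ (n * W.period p)
  have := hM (mem_image_of_mem X (Ico_subset_Icc_self hs))
  rw [← hXs, hn] at this
  linarith

/-! ### Circulation and the lower bound -/

/-- The vertical velocity along the streamline `p`. -/
noncomputable def lineVert (p x : ℝ) : ℝ := W.vertSpeed x (W.height x p)

/-- The negative velocity potential along the streamline `p`. -/
noncomputable def linePot (p x : ℝ) : ℝ := W.velPot x (W.height x p)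

/-- The derivative of the negative velocity potential along the streamline `p`. -/
noncomputable def linePotDeriv (p x : ℝ) : ℝ :=
  (W.lineSpeed p x ^ 2 + W.lineVert p x ^ 2) / W.lineSpeed p x

theorem lineVert_continuous : Continuous (Function.uncurry W.lineVert) :=
  W.vertSpeed_continuous.comp
    (continuous_snd.prodMk (W.height_continuous.comp continuous_swap))

theorem linePot_continuous : Continuous (Function.uncurry W.linePot) :=
  W.velPot_continuous.comp
    (continuous_snd.prodMk (W.height_continuous.comp continuous_swap))

theorem linePotDeriv_continuous : Continuous (Function.uncurry W.linePotDeriv) :=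
  ((W.lineSpeed_continuous.pow 2).add (W.lineVert_continuous.pow 2)).div W.lineSpeed_continuous
    fun z => (W.lineSpeed_pos z.1 z.2).ne'

variable {W} in
-- The chain rule covers p > 0; both sides are continuous in p, which gives the surface p = 0.
theorem integral_linePotDeriv {p : ℝ} (hp : 0 ≤ p) (a b : ℝ) :
    ∫ x in a..b, W.linePotDeriv p x = W.linePot p b - W.linePot p a := by
  have hpos : ∀ p, 0 < p → ∫ x in a..b, W.linePotDeriv p x = W.linePot p b - W.linePot p a := by
    intro p hp
    refine intervalIntegral.integral_eq_sub_of_hasDerivAt (fun x _ => ?_)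
      ((W.linePotDeriv_continuous.comp (Continuous.prodMk_right p)).intervalIntegrable _ _)
    refine (W.velPot_comp_hasDerivAt (hasDerivAt_id x) (height_hasDerivAt hp.le x)
      (height_lt hp x)).congr_deriv ?_
    have := (W.lineSpeed_pos p x).ne'
    simp only [id, linePotDeriv, lineVert]
    change _ * 1 - _ * (_ / W.lineSpeed p x) = _
    change W.lineSpeed p x * 1 - _ = _
    field_simp
    ring
  rcases hp.eq_or_lt with rfl | hp
  · have h1 : Tendsto (fun p => ∫ x in a..b, W.linePotDeriv p x) (𝓝[>] 0)
        (𝓝 (∫ x in a..b, W.linePotDeriv 0 x)) :=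
      ((intervalIntegral.continuous_parametric_intervalIntegral_of_continuous'
        W.linePotDeriv_continuous a b).tendsto 0).mono_left nhdsWithin_le_nhds
    have h2 : Tendsto (fun p => W.linePot p b - W.linePot p a) (𝓝[>] 0)
        (𝓝 (W.linePot 0 b - W.linePot 0 a)) := by
      refine Tendsto.mono_left (Continuous.tendsto ?_ 0) nhdsWithin_le_nhds
      exact (W.linePot_continuous.comp (Continuous.prodMk_left b)).sub
        (W.linePot_continuous.comp (Continuous.prodMk_left a))
    refine tendsto_nhds_unique (h1.congr' ?_) h2
    filter_upwards [self_mem_nhdsWithin] with p hp using hpos p hp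
  · exact hpos p hp

variable {W} in
theorem linePot_hasDerivAt {p : ℝ} (hp : 0 ≤ p) (x : ℝ) :
    HasDerivAt (W.linePot p) (W.linePotDeriv p x) x := by
  have hc : Continuous (W.linePotDeriv p) :=
    W.linePotDeriv_continuous.comp (Continuous.prodMk_right p)
  have h := (hc.integral_hasStrictDerivAt 0 x).hasDerivAt.const_add (W.linePot p 0)
  refine h.congr_of_eventuallyEq (Eventually.of_forall fun y => ?_)
  simp only [integral_linePotDeriv hp]
  ring

/-- The circulation over one wavelength is that of the uniform flow at infinite depth. -/
theorem velPot_add_lam (x y : ℝ) : W.velPot (x + W.lam) y = W.velPot x y + W.c * W.lam := by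
  have hd : ∀ s, HasDerivAt (fun s => W.velPot (x + W.lam) s - W.velPot x s) 0 s := fun s => by
    refine ((W.velPot_hasDerivAt_vert _ s).sub (W.velPot_hasDerivAt_vert x s)).congr_deriv ?_
    rw [vertSpeed_add_lam]
    ring
  have hconst := is_const_of_deriv_eq_zero (fun s => (hd s).differentiableAt)
    (fun s => (hd s).deriv)
  obtain ⟨b, hb⟩ := W.exists_depth
  suffices h : ∀ ε > 0, |W.velPot (x + W.lam) y - W.velPot x y - W.c * W.lam| ≤ ε * W.lam by
    have h0 : |W.velPot (x + W.lam) y - W.velPot x y - W.c * W.lam| ≤ 0 := by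
      refine le_of_forall_pos_le_add fun ε hε => ?_
      have := h (ε / W.lam) (div_pos hε W.lam_pos)
      rwa [div_mul_cancel₀ _ W.lam_pos.ne', ← zero_add ε] at this
    have := abs_nonpos_iff.1 h0
    linarith
  intro ε hε
  -- The increment over a wavelength does not depend on the height, so it may be computed at a depth
  -- where c - u is within ε of c.
  obtain ⟨y₁, hy₁, hy₁b⟩ := ((W.eventually_relSpeed_near hε).and (eventually_le_atBot b)).exists
  have hcont : Continuous fun s => W.relSpeed s y₁ :=
    W.relSpeed_continuous.comp (Continuous.prodMk_left y₁)
  have hint : ∫ s in x..x + W.lam, W.relSpeed s y₁ = W.velPot (x + W.lam) y₁ - W.velPot x y₁ := by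
    refine intervalIntegral.integral_eq_sub_of_hasDerivAt (f := fun s => W.velPot s y₁)
      (fun s _ => ?_) (hcont.intervalIntegrable _ _)
    simpa using W.velPot_comp_hasDerivAt (hasDerivAt_id s) (hasDerivAt_const s y₁)
      (hy₁b.trans_lt (hb _))
  have hc : ∫ s in x..x + W.lam, (W.relSpeed s y₁ - W.c) =
      W.velPot (x + W.lam) y - W.velPot x y - W.c * W.lam := by
    rw [intervalIntegral.integral_sub (hcont.intervalIntegrable _ _)
      (continuous_const.intervalIntegrable _ _), hint, intervalIntegral.integral_const,
      hconst y₁ y, smul_eq_mul]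
    ring
  rw [← hc, ← Real.norm_eq_abs]
  have := intervalIntegral.norm_integral_le_of_norm_le_const (a := x) (b := x + W.lam) (C := ε)
    (f := fun s => W.relSpeed s y₁ - W.c) (fun s _ => (hy₁ s).le)
  rwa [add_sub_cancel_left, abs_of_pos W.lam_pos] at this

theorem linePot_add_lam (p x : ℝ) : W.linePot p (x + W.lam) = W.linePot p x + W.c * W.lam := by
  rw [linePot, height_add_lam, velPot_add_lam, linePot]

variable {W} in
-- Expanding the square splits the integrand into 1/U - 2/c + (U² + v²)/(U c²), and the circulation
-- cλ evaluates the last term to λ/c.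
theorem period_eq_add_integral {p : ℝ} (hp : 0 ≤ p) :
    W.period p = W.lam / W.c + ∫ x in (-(W.lam / 2))..(W.lam / 2),
      ((W.lineSpeed p x - W.c) ^ 2 + W.lineVert p x ^ 2) / (W.lineSpeed p x * W.c ^ 2) := by
  have hc := W.c_pos.ne'
  have h1 : ∀ x, ((W.lineSpeed p x - W.c) ^ 2 + W.lineVert p x ^ 2) / (W.lineSpeed p x * W.c ^ 2)
      = (1 / W.lineSpeed p x - 2 / W.c) + W.linePotDeriv p x * (1 / W.c ^ 2) := by
    intro x
    have := (W.lineSpeed_pos p x).ne'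
    rw [linePotDeriv]
    field_simp
    ring
  have hs := (W.slowness_continuous p).intervalIntegrable (μ := MeasureTheory.volume)
    (-(W.lam / 2)) (W.lam / 2)
  have hA : Continuous (W.linePotDeriv p) :=
    W.linePotDeriv_continuous.comp (Continuous.prodMk_right p)
  have hA' : IntervalIntegrable (fun x => W.linePotDeriv p x * (1 / W.c ^ 2))
      MeasureTheory.volume (-(W.lam / 2)) (W.lam / 2) :=
    (hA.mul continuous_const).intervalIntegrable _ _
  have hcirc := W.linePot_add_lam p (-(W.lam / 2))
  rw [show -(W.lam / 2) + W.lam = W.lam / 2 by ring] at hcirc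
  simp only [h1]
  rw [intervalIntegral.integral_add (hs.sub (continuous_const.intervalIntegrable _ _))
    hA', intervalIntegral.integral_sub hs
    (continuous_const.intervalIntegrable _ _), intervalIntegral.integral_mul_const,
    integral_linePotDeriv hp, intervalIntegral.integral_const, hcirc, ← period, smul_eq_mul]
  field_simp
  ring

theorem isPreconnected_fluid : IsPreconnected W.fluid := by
  have hη := W.η_continuous
  have himg : W.fluid = (fun z : ℝ × ℝ => (z.1 : ℂ) + ((W.η z.1 - z.2 : ℝ) : ℂ) * Complex.I) ''
      (univ ×ˢ Ioi 0) := by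
    ext z
    constructor
    · intro (hz : z.im < W.η z.re)
      exact ⟨(z.re, W.η z.re - z.im), ⟨mem_univ _, sub_pos.2 hz⟩, by apply Complex.ext <;> simp⟩
    · rintro ⟨w, ⟨-, hw⟩, rfl⟩
      have : 0 < w.2 := hw
      simpa [fluid] using this
  rw [himg]
  exact (isPreconnected_univ.prod isPreconnected_Ioi).image _ (by fun_prop)

variable {W} in
/-- If the flow were uniform along one streamline, it would be uniform. -/
theorem cvel_eq_of_uniform_streamline {p : ℝ} (hp : 0 < p)
    (h : ∀ᶠ x in 𝓝 (0 : ℝ), W.cvel (x + W.height x p * Complex.I) = W.c * Complex.I) :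
    EqOn W.cvel (fun _ => W.c * Complex.I) W.fluid := by
  have han : AnalyticOnNhd ℂ W.cvel W.fluid := DifferentiableOn.analyticOnNhd
    (fun z hz => (W.cvel_differentiableAt hz).differentiableWithinAt) W.isOpen_fluid
  let γ : ℝ → ℂ := fun x => x + W.height x p * Complex.I
  have hγ : Continuous γ := by
    have : Continuous fun x => W.height x p := W.height_continuous.comp (Continuous.prodMk_left p)
    fun_prop
  have hγre : ∀ x, (γ x).re = x := fun x => by simp [γ]
  have hmem : γ 0 ∈ W.fluid := by simpa [fluid, γ] using height_lt hp 0
  refine han.eqOn_of_preconnected_of_frequently_eq analyticOnNhd_const W.isPreconnected_fluid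
    hmem ?_
  -- The streamline is a graph, so its points with x ≠ 0 differ from `γ 0` and accumulate there, as
  -- the identity theorem requires.
  have ht : Tendsto γ (𝓝[≠] 0) (𝓝[≠] (γ 0)) := by
    refine tendsto_nhdsWithin_iff.2 ⟨hγ.continuousAt.mono_left nhdsWithin_le_nhds, ?_⟩
    filter_upwards [self_mem_nhdsWithin] with x hx heq
    exact hx (by rw [mem_singleton_iff, ← hγre x, heq, hγre])
  exact ht.frequently (h.filter_mono nhdsWithin_le_nhds).frequently

variable {W} in
-- Otherwise v vanishes on the surface from trough to crest: directly if p = 0, through the identity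
-- theorem and a limit from below if p > 0. Then η' = 0 there, against the strict monotonicity of
-- the profile.
theorem exists_nonuniform {p : ℝ} (hp : 0 ≤ p) : ∃ x ∈ Icc (-(W.lam / 2)) (W.lam / 2),
    W.lineSpeed p x ≠ W.c ∨ W.lineVert p x ≠ 0 := by
  have hlam := W.lam_pos
  by_contra! hcon
  have hv : ∀ x ∈ Icc (-(W.lam / 2)) 0, W.vertSpeed x (W.η x) = 0 := by
    rcases hp.eq_or_lt with rfl | hp
    · intro x hx
      have := (hcon x ⟨hx.1, by linarith [hx.2]⟩).2
      rwa [lineVert, height_zero] at this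
    · have hunif := cvel_eq_of_uniform_streamline (W := W) hp (by
        filter_upwards [Icc_mem_nhds (a := -(W.lam / 2)) (b := W.lam / 2) (by linarith)
          (by linarith)] with x hx
        have := hcon x hx
        rw [lineSpeed, lineVert] at this
        apply Complex.ext
        · simp [cvel_re, this]
        · simp [cvel_im, this])
      intro x _
      let S : ℝ → ℂ := fun e => x + ((W.η x - e : ℝ) : ℂ) * Complex.I
      have hS : Continuous S := by fun_prop
      have h1 : Tendsto (fun e => W.cvel (S e)) (𝓝[>] 0) (𝓝 (W.cvel (S 0))) :=
        ((W.cvel_continuous.comp hS).tendsto 0).mono_left nhdsWithin_le_nhds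
      have h2 : W.cvel (S 0) = W.c * Complex.I := by
        refine tendsto_nhds_unique (h1.congr' ?_) tendsto_const_nhds
        filter_upwards [self_mem_nhdsWithin] with e he
        refine hunif ?_
        have : (0 : ℝ) < e := he
        simpa [S, fluid] using this
      have h3 := W.cvel_re (S 0)
      rw [h2] at h3
      simpa [S] using h3.symm
  have hη' : ∀ x ∈ Icc (-(W.lam / 2)) 0, deriv W.η x = 0 := by
    intro x hx
    have h1 := hv x hx
    rw [vertSpeed_of_le le_rfl, W.kinematic] at h1
    exact (mul_eq_zero.1 h1).resolve_left (sub_neg.2 (W.u_lt_c x _ le_rfl)).ne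
  have hle : -(W.lam / 2) ≤ 0 := by linarith
  have hconst := constant_of_has_deriv_right_zero W.η_continuous.continuousOn
    (fun x hx => hη' x (Ico_subset_Icc_self hx) ▸ (W.η_hasDerivAt x).hasDerivWithinAt)
    0 (right_mem_Icc.2 hle)
  exact (W.η_strictMonoOn (left_mem_Icc.2 hle) (right_mem_Icc.2 hle) (by linarith)).ne' hconst

variable {W} in
theorem lam_div_c_lt_period {p : ℝ} (hp : 0 ≤ p) : W.lam / W.c < W.period p := by
  have hpos : ∀ x, 0 < W.lineSpeed p x * W.c ^ 2 := fun x =>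
    mul_pos (W.lineSpeed_pos p x) (pow_pos W.c_pos 2)
  have hU : Continuous (W.lineSpeed p) := W.lineSpeed_continuous.comp (Continuous.prodMk_right p)
  have hV : Continuous (W.lineVert p) := W.lineVert_continuous.comp (Continuous.prodMk_right p)
  obtain ⟨x, hx, hne⟩ := exists_nonuniform hp
  rw [period_eq_add_integral hp, lt_add_iff_pos_right]
  refine intervalIntegral.integral_pos (by linarith [W.lam_pos])
    (Continuous.div (by fun_prop) (by fun_prop) fun x => (hpos x).ne').continuousOn
    (fun x _ => div_nonneg (by positivity) (hpos x).le) ⟨x, hx, div_pos ?_ (hpos x)⟩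
  rcases hne with h | h
  · have := sub_ne_zero.2 h
    positivity
  · positivity

end DeepWaterStokesWave

/-! ### Quadratic means of bounded holomorphic functions on a half-plane -/

open Complex in
/-- The correlation of a bounded holomorphic function on the right half-plane with a continuous
function on a vertical segment is holomorphic. -/
theorem hasDerivAt_integral_mul_translate {f : ℂ → ℂ} (hc : Continuous f)
    (hd : ∀ z : ℂ, 0 < z.re → DifferentiableAt ℂ f z) {C : ℝ} (hC : ∀ z, ‖f z‖ ≤ C)
    {k : ℝ → ℂ} (hk : Continuous k) (L : ℝ) {w : ℂ} (hw : 0 < w.re) :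
    HasDerivAt (fun z => ∫ s in (0 : ℝ)..L, f (z + s * I) * k s)
      (∫ s in (0 : ℝ)..L, deriv f (w + s * I) * k s) w := by
  -- With `z` within this radius of `w`, a disc of the same radius about `z + s * I` stays in the
  -- right half-plane, so Cauchy's estimate bounds the derivative by `C / (w.re / 2)`.
  have hρ : 0 < w.re / 2 := half_pos hw
  have hre : ∀ z ∈ Metric.ball w (w.re / 2), ∀ s : ℝ, ∀ y ∈ Metric.ball (z + s * I) (w.re / 2),
      0 < y.re := by
    intro z hz s y hy
    rw [Metric.mem_ball, dist_eq_norm] at hz hy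
    have h1 := (abs_lt.1 ((abs_re_le_norm _).trans_lt hz)).1
    have h2 := (abs_lt.1 ((abs_re_le_norm _).trans_lt hy)).1
    simp at h1 h2
    linarith
  refine (intervalIntegral.hasDerivAt_integral_of_dominated_loc_of_deriv_le
    (F := fun z s => f (z + s * I) * k s) (F' := fun z s => deriv f (z + s * I) * k s)
    (bound := fun s => C / (w.re / 2) * ‖k s‖) (Metric.ball_mem_nhds w hρ) ?_ ?_ ?_ ?_ ?_ ?_).2
  · refine Eventually.of_forall fun z => Continuous.aestronglyMeasurable ?_
    exact (hc.comp (by fun_prop)).mul hk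
  · exact ((hc.comp (by fun_prop)).mul hk).intervalIntegrable _ _
  · refine Measurable.aestronglyMeasurable ?_
    exact ((measurable_deriv f).comp (by fun_prop : Continuous fun s : ℝ => w + s * I).measurable).mul
      hk.measurable
  · refine MeasureTheory.ae_of_all _ fun s _ z hz => ?_
    rw [norm_mul]
    refine mul_le_mul_of_nonneg_right ?_ (norm_nonneg _)
    refine norm_deriv_le_of_forall_mem_sphere_norm_le hρ ⟨fun y hy => ?_, hc.continuousOn⟩
      fun y _ => hC y
    exact (hd y (hre z hz s y hy)).differentiableWithinAt
  · exact (continuous_const.mul hk.norm).intervalIntegrable _ _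
  · refine MeasureTheory.ae_of_all _ fun s _ z hz => ?_
    have := (hd (z + s * I) (hre z hz s _ (Metric.mem_ball_self hρ))).hasDerivAt
    exact (this.comp_add_const z (s * I)).mul_const (k s)

open Complex in
/-- The quadratic mean of a bounded holomorphic function on the right half-plane with an imaginary
period is at most its quadratic mean on the boundary. -/
theorem integral_norm_sq_le_of_periodic {f : ℂ → ℂ} (hc : Continuous f)
    (hd : ∀ z : ℂ, 0 < z.re → DifferentiableAt ℂ f z) {C : ℝ} (hC : ∀ z, ‖f z‖ ≤ C)
    {L : ℝ} (hL : 0 ≤ L) (hper : ∀ s : ℝ, f ((s + L : ℝ) * I) = f (s * I)) {p : ℝ} (hp : 0 ≤ p) :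
    ∫ s in (0 : ℝ)..L, ‖f (p + s * I)‖ ^ 2 ≤ ∫ s in (0 : ℝ)..L, ‖f (s * I)‖ ^ 2 := by
  have hcp : Continuous fun s : ℝ => f (p + s * I) := hc.comp (by fun_prop)
  have hck : Continuous fun s : ℝ => (starRingEnd ℂ) (f (p + s * I)) := continuous_conj.comp hcp
  set Tp := ∫ s in (0 : ℝ)..L, ‖f (p + s * I)‖ ^ 2 with hTp
  set T0 := ∫ s in (0 : ℝ)..L, ‖f (s * I)‖ ^ 2 with hT0
  -- The conjugated factor is frozen on the line Re = p, so `g` is holomorphic in `w`, and its value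
  -- at p is the quadratic mean sought.
  let g : ℂ → ℂ := fun w => ∫ s in (0 : ℝ)..L, f (w + s * I) * (starRingEnd ℂ) (f (p + s * I))
  have hgp : g p = Tp := by
    simp only [g, mul_conj, normSq_eq_norm_sq]
    rw [hTp, ← intervalIntegral.integral_ofReal]
  have hgc : Continuous g := by
    refine intervalIntegral.continuous_parametric_intervalIntegral_of_continuous'
      (f := fun (w : ℂ) (s : ℝ) => f (w + s * I) * (starRingEnd ℂ) (f (p + s * I))) ?_ _ _
    exact (hc.comp (by fun_prop)).mul (hck.comp continuous_snd)
  have hC0 : 0 ≤ C := (norm_nonneg _).trans (hC 0)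
  have hgb : ∀ w, ‖g w‖ ≤ C * C * |L - 0| := fun w =>
    intervalIntegral.norm_integral_le_of_norm_le_const fun s _ => by
      rw [norm_mul, norm_conj]
      exact mul_le_mul (hC _) (hC _) (norm_nonneg _) hC0
  -- The inequality ab ≤ (a² + b²)/2 under the integral; periodicity on the imaginary axis makes the
  -- shift by x harmless.
  have hgi : ∀ x : ℝ, ‖g (x * I)‖ ≤ (T0 + Tp) / 2 := by
    intro x
    have hcx : Continuous fun s : ℝ => f (x * I + s * I) := hc.comp (by fun_prop)
    have hshift : ∫ s in (0 : ℝ)..L, ‖f (x * I + s * I)‖ ^ 2 = T0 := by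
      have hpf : Function.Periodic (fun s : ℝ => ‖f (s * I)‖ ^ 2) L := fun s => by
        simp only [hper]
      have h1 := hpf.intervalIntegral_add_eq x 0
      rw [zero_add] at h1
      have h2 := intervalIntegral.integral_comp_add_right (a := 0) (b := L)
        (fun s : ℝ => ‖f (s * I)‖ ^ 2) x
      rw [zero_add, add_comm L x] at h2
      rw [hT0, ← h1, ← h2]
      refine intervalIntegral.integral_congr fun s _ => ?_
      simp only [ofReal_add, add_mul, add_comm]
    have i1 : IntervalIntegrable (fun s : ℝ => ‖f (x * I + s * I)‖ ^ 2)
        MeasureTheory.volume 0 L := (hcx.norm.pow 2).intervalIntegrable _ _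
    have i2 : IntervalIntegrable (fun s : ℝ => ‖f (p + s * I)‖ ^ 2)
        MeasureTheory.volume 0 L := (hcp.norm.pow 2).intervalIntegrable _ _
    calc ‖g (x * I)‖ ≤ ∫ s in (0 : ℝ)..L,
          ‖f (x * I + s * I) * (starRingEnd ℂ) (f (p + s * I))‖ :=
          intervalIntegral.norm_integral_le_integral_norm hL
      _ ≤ ∫ s in (0 : ℝ)..L, (‖f (x * I + s * I)‖ ^ 2 + ‖f (p + s * I)‖ ^ 2) / 2 := by
          refine intervalIntegral.integral_mono_on hL ((hcx.mul hck).norm.intervalIntegrable _ _)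
            ((i1.add i2).div_const 2) fun s _ => ?_
          rw [norm_mul, norm_conj]
          nlinarith [sq_nonneg (‖f (x * I + s * I)‖ - ‖f (p + s * I)‖)]
      _ = (T0 + Tp) / 2 := by
          rw [intervalIntegral.integral_div, intervalIntegral.integral_add i1 i2, hshift]
  have hPL : ‖g p‖ ≤ (T0 + Tp) / 2 := by
    refine PhragmenLindelof.right_half_plane_of_bounded_on_real
      ⟨fun w hw => (hasDerivAt_integral_mul_translate hc hd hC hck L
        hw).differentiableAt.differentiableWithinAt, hgc.continuousOn⟩
      ⟨1, one_lt_two, 0, ?_⟩ ?_ hgi (by simpa using hp)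
    · refine Asymptotics.IsBigO.of_bound (C * C * |L - 0|) (Eventually.of_forall fun w => ?_)
      simpa using hgb w
    · exact isBoundedUnder_of ⟨_, fun x => hgb x⟩
  rw [hgp, norm_real] at hPL
  have := (le_abs_self Tp).trans hPL
  linarith

/-! ### The inverse of the potential and the upper bound -/

namespace DeepWaterStokesWave

variable (W : DeepWaterStokesWave)

/-- The slope (U² + v²)/U is at least U ≥ δ. It is available for p ≥ 0 only, hence `max p 0`, which
keeps the inverse continuous on the whole plane. -/
theorem exists_foot : ∃ r : ℝ → ℝ → ℝ, Continuous (Function.uncurry r) ∧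
    (∀ p q, W.linePot (max p 0) (r p q) = q) ∧ ∀ p x, r p (W.linePot (max p 0) x) = x := by
  obtain ⟨δ, K, hδ, hb⟩ := W.exists_relSpeed_bounds
  refine exists_continuous_fiberwise_inverse (G := fun p x => W.linePot (max p 0) x)
    (W.linePot_continuous.comp
      ((continuous_fst.max continuous_const).prodMk continuous_snd)) hδ fun p a b hab => ?_
  have hd := linePot_hasDerivAt (W := W) (le_max_right p 0)
  refine mul_sub_le_image_sub_of_le_deriv (fun y => (hd y).differentiableAt) (fun y => ?_) hab
  rw [(hd y).deriv, linePotDeriv, le_div_iff₀ (W.lineSpeed_pos _ _)]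
  have hU : δ ≤ W.lineSpeed (max p 0) y := (hb _ _).1
  nlinarith [sq_nonneg (W.lineVert (max p 0) y), W.lineSpeed_pos (max p 0) y]

/-- The abscissa of the point of the streamline `p` with negative velocity potential `q`. -/
noncomputable def foot (p q : ℝ) : ℝ := W.exists_foot.choose p q

theorem foot_continuous : Continuous (Function.uncurry W.foot) := W.exists_foot.choose_spec.1

variable {W} in
theorem linePot_foot {p : ℝ} (hp : 0 ≤ p) (q : ℝ) : W.linePot p (W.foot p q) = q := by
  have := W.exists_foot.choose_spec.2.1 p q
  rwa [max_eq_left hp] at this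

variable {W} in
theorem foot_linePot {p : ℝ} (hp : 0 ≤ p) (x : ℝ) : W.foot p (W.linePot p x) = x := by
  have := W.exists_foot.choose_spec.2.2 p x
  rwa [max_eq_left hp] at this

variable {W} in
theorem foot_add_circulation {p : ℝ} (hp : 0 ≤ p) (q : ℝ) :
    W.foot p (q + W.c * W.lam) = W.foot p q + W.lam := by
  rw [← foot_linePot hp (W.foot p q + W.lam), linePot_add_lam, linePot_foot hp]

/-- The inverse of the complex potential on the closed right half-plane, continued to the plane. -/
noncomputable def invPotential (w : ℂ) : ℂ :=
  W.foot w.re w.im + W.height (W.foot w.re w.im) (max w.re 0) * Complex.I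

theorem invPotential_continuous : Continuous W.invPotential := by
  have h1 : Continuous fun w : ℂ => W.foot w.re w.im :=
    W.foot_continuous.comp (Complex.continuous_re.prodMk Complex.continuous_im)
  have h2 : Continuous fun w : ℂ => W.height (W.foot w.re w.im) (max w.re 0) :=
    W.height_continuous.comp (h1.prodMk (Complex.continuous_re.max continuous_const))
  unfold invPotential
  fun_prop

variable {W} in
theorem potential_invPotential {w : ℂ} (hw : 0 ≤ w.re) : W.potential (W.invPotential w) = w := by
  rw [invPotential, max_eq_left hw]
  apply Complex.ext
  · exact W.stream_height _ _
  · exact linePot_foot hw _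

variable {W} in
theorem invPotential_mem_fluid {w : ℂ} (hw : 0 < w.re) : W.invPotential w ∈ W.fluid := by
  have := height_lt (W := W) hw (W.foot w.re w.im)
  simpa [fluid, invPotential, max_eq_left hw.le] using this

variable {W} in
theorem invPotential_hasDerivAt {w : ℂ} (hw : 0 < w.re) :
    HasDerivAt W.invPotential (W.cvel (W.invPotential w))⁻¹ w := by
  refine HasDerivAt.of_local_left_inverse W.invPotential_continuous.continuousAt
    (W.potential_hasDerivAt (invPotential_mem_fluid hw)) (W.cvel_ne_zero _) ?_
  filter_upwards [(isOpen_lt continuous_const Complex.continuous_re).mem_nhds hw] with z hz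
  exact potential_invPotential (le_of_lt hz)

/-- The derivative of the inverse of the complex potential. -/
noncomputable def invVel (w : ℂ) : ℂ := (W.cvel (W.invPotential w))⁻¹

theorem invVel_continuous : Continuous W.invVel :=
  (W.cvel_continuous.comp W.invPotential_continuous).inv₀ fun _ => W.cvel_ne_zero _

variable {W} in
theorem invVel_differentiableAt {w : ℂ} (hw : 0 < w.re) : DifferentiableAt ℂ W.invVel w :=
  ((W.cvel_differentiableAt (invPotential_mem_fluid hw)).comp w
    (invPotential_hasDerivAt hw).differentiableAt).inv (W.cvel_ne_zero _)

theorem exists_norm_invVel_le : ∃ C : ℝ, ∀ w, ‖W.invVel w‖ ≤ C := by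
  obtain ⟨δ, K, hδ, hb⟩ := W.exists_relSpeed_bounds
  refine ⟨δ⁻¹, fun w => ?_⟩
  rw [invVel, norm_inv]
  exact inv_anti₀ hδ ((hb _ _).1.trans (W.relSpeed_le_norm_cvel _))

theorem invVel_periodic (s : ℝ) :
    W.invVel ((s + W.c * W.lam : ℝ) * Complex.I) = W.invVel (s * Complex.I) := by
  have h := foot_add_circulation (W := W) le_rfl s
  simp only [invVel, invPotential, cvel]
  simp [h, height_add_lam, relSpeed_add_lam, vertSpeed_add_lam]

variable {W} in
-- Substitute q = `linePot p x`: then dq = (U² + v²)/U dx and |f|² = 1/(U² + v²), so |f|² dq = dx/U.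
theorem period_eq_integral_norm_sq {p : ℝ} (hp : 0 ≤ p) :
    W.period p = ∫ s in (0 : ℝ)..W.c * W.lam, ‖W.invVel (p + s * Complex.I)‖ ^ 2 := by
  have hcv := intervalIntegral.integral_comp_mul_deriv (a := W.foot p 0)
    (b := W.foot p 0 + W.lam) (f := W.linePot p) (f' := W.linePotDeriv p)
    (g := fun s : ℝ => ‖W.invVel (p + s * Complex.I)‖ ^ 2) (fun x _ => linePot_hasDerivAt hp x)
    (W.linePotDeriv_continuous.comp (Continuous.prodMk_right p)).continuousOn
    ((W.invVel_continuous.comp (by fun_prop)).norm.pow 2)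
  rw [linePot_add_lam, linePot_foot hp, zero_add] at hcv
  rw [← hcv, ← W.integral_slowness_eq_period p (W.foot p 0)]
  refine intervalIntegral.integral_congr fun x _ => ?_
  have hinv : W.invPotential (p + W.linePot p x * Complex.I) = x + W.height x p * Complex.I := by
    simp [invPotential, foot_linePot hp, max_eq_left hp]
  have hU := W.lineSpeed_pos p x
  simp only [Function.comp, invVel, hinv, norm_inv, inv_pow, normSq_cvel]
  simp only [Complex.add_re, Complex.add_im, Complex.ofReal_re, Complex.ofReal_im,
    Complex.re_ofReal_mul, Complex.im_ofReal_mul, Complex.I_re, Complex.I_im, mul_zero, mul_one,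
    add_zero, zero_add]
  rw [linePotDeriv]
  change _ = (W.lineSpeed p x ^ 2 + W.lineVert p x ^ 2)⁻¹ * _
  have hne : W.lineSpeed p x ^ 2 + W.lineVert p x ^ 2 ≠ 0 := by positivity
  field_simp

variable {W} in
theorem period_le_period_zero {p : ℝ} (hp : 0 ≤ p) : W.period p ≤ W.period 0 := by
  obtain ⟨C, hC⟩ := W.exists_norm_invVel_le
  rw [period_eq_integral_norm_sq hp, period_eq_integral_norm_sq le_rfl]
  simpa using integral_norm_sq_le_of_periodic W.invVel_continuous
    (fun z hz => invVel_differentiableAt hz) hC (mul_pos W.c_pos W.lam_pos).le W.invVel_periodic hp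

theorem lineSpeed_zero (x : ℝ) : W.lineSpeed 0 x = W.c - W.u x (W.η x) := by
  rw [lineSpeed, height_zero, relSpeed_of_le le_rfl]

variable {W} in
theorem drift_pos {p : ℝ} (hp : 0 ≤ p) : 0 < W.c * W.period p - W.lam := by
  have := (div_lt_iff₀ W.c_pos).1 (lam_div_c_lt_period hp)
  linarith

variable {W} in
/-- On a streamline, a stream function may be replaced by `W.stream`. -/
theorem IsStreamFunction.onStreamlineAt_iff {ψ : ℝ → ℝ → ℝ} (hψ : W.IsStreamFunction ψ)
    {X Y : ℝ → ℝ} (h : W.IsParticlePath X Y) (p t₀ : ℝ) :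
    W.OnStreamlineAt ψ p X Y t₀ ↔ W.OnStreamlineAt W.stream p X Y t₀ := by
  rw [OnStreamlineAt, OnStreamlineAt, hψ.eq_stream (h.mem_fluid t₀)]

end DeepWaterStokesWave

theorem theorem4p2 (W : DeepWaterStokesWave) :
    -- the stream function exists
    (∃ ψ : ℝ → ℝ → ℝ, W.IsStreamFunction ψ) ∧
    -- particle paths exist for all initial data in the fluid or on its surface
    (∀ t₀ x₀ y₀ : ℝ, y₀ ≤ W.η (x₀ - W.c * t₀) →
      ∃ X Y : ℝ → ℝ, W.IsParticlePath X Y ∧ X t₀ = x₀ ∧ Y t₀ = y₀) ∧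
    ∀ ψ : ℝ → ℝ → ℝ, W.IsStreamFunction ψ →
      ∃ T : ℝ → ℝ,
        (∀ p : ℝ, 0 ≤ p → W.IsStreamlineTimePeriod ψ p (T p)) ∧
        -- bounds for the streamline time-period
        IntervalIntegrable (fun x => 1 / (W.c - W.u x (W.η x))) MeasureTheory.volume
          (-(W.lam / 2)) (W.lam / 2) ∧
        (∀ p : ℝ, 0 ≤ p →
          W.lam / W.c < T p ∧
          T p ≤ ∫ x in (-(W.lam / 2))..(W.lam / 2), 1 / (W.c - W.u x (W.η x))) ∧
        -- no particle path is closed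
        (∀ X Y : ℝ → ℝ, W.IsParticlePath X Y → ¬ DeepWaterStokesWave.IsClosedPath X Y) ∧
        -- the drift is positive
        (∀ p : ℝ, 0 ≤ p → ∀ (X Y : ℝ → ℝ) (t₀ : ℝ),
          W.IsParticlePath X Y → W.OnStreamlineAt ψ p X Y t₀ →
            X (T p + t₀) - X t₀ = W.c * T p - W.lam ∧ 0 < W.c * T p - W.lam) := by
  refine ⟨⟨W.stream, W.stream_isStreamFunction⟩, fun t₀ x₀ y₀ h => W.exists_particlePath h,
    fun ψ hψ => ⟨W.period, fun p hp => ?_, ?_, fun p hp =>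
      ⟨DeepWaterStokesWave.lam_div_c_lt_period hp, ?_⟩, fun X Y h =>
      h.not_isClosedPath fun p hp => DeepWaterStokesWave.drift_pos hp,
      fun p hp X Y t₀ h hon => ⟨?_, DeepWaterStokesWave.drift_pos hp⟩⟩⟩
  · obtain ⟨⟨X, Y, t₀, h, hon⟩, huniq⟩ := W.isStreamlineTimePeriod_period hp
    exact ⟨⟨X, Y, t₀, h, (hψ.onStreamlineAt_iff h p t₀).2 hon⟩, fun X Y t₀ h hon =>
      huniq X Y t₀ h ((hψ.onStreamlineAt_iff h p t₀).1 hon)⟩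
  · simpa only [W.lineSpeed_zero] using (W.slowness_continuous 0).intervalIntegrable _ _
  · have := DeepWaterStokesWave.period_le_period_zero (W := W) hp
    simpa only [DeepWaterStokesWave.period, W.lineSpeed_zero] using this
  · have := h.add_period ((hψ.onStreamlineAt_iff h p t₀).1 hon)
    linarith
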